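/- Links are unoriented links in $S^3$ up to ambient isotopy. A marking $\omega$ of a link $L$ assigns $0$ or $1$ to each component; $(L,\omega)$ is a two-fold marked link if the number of $1$'s is even, and an odd-marked link if it is odd. A marking is drawn on a diagram $D$ of $L$ by dots on its arcs, $\omega(K)$ being the number of dots on the component $K$ modulo $2$; when a crossing of the dotted diagram is smoothed, the dots are carried along. The determinant $\det(L)$ is the order of $H_1(\Sigma(L);\mathbb{Z})$, where $\Sigma(L)$ is the double cover of $S^3$ branched along $L$, and $\det(L)=0$ if this group is infinite. Let $\mathcal{Q}_2$ be the smallest set of two-fold marked links such that: (1) the unknot with trivial marking is in $\mathcal{Q}_2$; (2) every two-fold marked link that splits (along a 2-sphere) into two odd-marked links is in $\mathcal{Q}_2$; (3) if $(L,\omega)$ has a dotted diagram whose two smoothings at some crossing represent $(L_0,\omega_0),(L_1,\omega_1)\in\mathcal{Q}_2$ with $\det(L)=\det(L_0)+\det(L_1)$, then $(L,\omega)\in\mathcal{Q}_2$. A link $L$ is TQA if $L$ with the trivial marking is in $\mathcal{Q}_2$. For $p,q\in\mathbb{Z}$ let $K_{p,q}$ be the Kanenobu knot with $p$ and $q$ half-twists,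 described as follows. Take the standard 4-crossing diagram of the figure-eight knot $4_1$, with a triangular face as its outer face, beside a vertical axis, and its mirror image in the axis, so that the three outer edges lie along the axis. Exactly one of these edges borders a bigon. At one of the other two edges form the connected sum of the two diagrams across the axis. At the edge that borders a bigon, twist the two strands on either side of the axis around each other by $p$ half-twists (crossings on the axis), and at the remaining edge by $q$ half-twists of the same handedness convention. (Thus $K_{0,0}=4_1\#4_1$.) Then for all $p,q\in\mathbb{Z}$, $K_{p,q}$ is a knot with $\det(K_{p,q})=25$, and it is TQA. Consequently there are infinitely many pairwise non-isotopic TQA knots of determinant $25$. -/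

import Mathlib

namespace TwoFold

/-! ### Dotted link diagrams

A link diagram in the plane is put in general position with respect to the height function and
read from bottom to top as a finite list of elementary events. Between two events one sees a row of
vertical strands, numbered `0, 1, 2, …` from left to right. Dots on the arcs of the diagram are
recorded as events too. -/

/-- An elementary event.
* `cup i`: a local minimum, creating two new strands which get the numbers `i` and `i + 1`;
* `cap i`: a local maximum, joining the strands `i` and `i + 1`, which end there;
* `crossing b i`: the strands `i` and `i + 1` cross; if `b = true`, the strand running from the
  bottom left to the top right is the overstrand, if `b = false`, it is the strand running from the
  bottom right to the top left;
* `dot i`: a dot placed on the strand `i`. -/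
inductive Slice : Type
  | cup (i : ℕ) : Slice
  | cap (i : ℕ) : Slice
  | crossing (b : Bool) (i : ℕ) : Slice
  | dot (i : ℕ) : Slice

/-- The number of the leftmost strand that takes part in the event. -/
def Slice.pos : Slice → ℕ
  | .cup i => i
  | .cap i => i
  | .crossing _ i => i
  | .dot i => i

/-- The number of strands that enter the event from below. -/
def Slice.ins : Slice → ℕ
  | .cup _ => 0
  | .cap _ => 2
  | .crossing _ _ => 2
  | .dot _ => 1

/-- The number of strands that leave the event at the top. -/
def Slice.outs : Slice → ℕ
  | .cup _ => 2
  | .cap _ => 0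
  | .crossing _ _ => 2
  | .dot _ => 1

/-- The same event, `d` strands further to the right. -/
def Slice.shift (d : ℕ) : Slice → Slice
  | .cup i => .cup (i + d)
  | .cap i => .cap (i + d)
  | .crossing b i => .crossing b (i + d)
  | .dot i => .dot (i + d)

/-- Whether the event is a dot. -/
def Slice.isDot : Slice → Bool
  | .dot _ => true
  | _ => false

/-- The number of strands above a list of events, read from bottom to top, that starts with `n`
strands; `none` if some event involves a strand that is not there. -/
def run : ℕ → List Slice → Option ℕ
  | n, [] => some n
  | n, s :: w => if s.pos + s.ins ≤ n then run (n - s.ins + s.outs) w else none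

theorem run_append (n : ℕ) (u v : List Slice) :
    run n (u ++ v) = (run n u).bind fun m => run m v := by
  induction u generalizing n with
  | nil => simp [run]
  | cons s u ih =>
    simp only [List.cons_append, run]
    split
    · exact ih _
    · rfl

/-- A dotted diagram: a list of events that starts and ends with no strands at all. -/
@[ext]
structure DottedDiagram : Type where
  word : List Slice
  closed : run 0 word = some 0

namespace DottedDiagram

/-- The number of dots. -/
def numDots (D : DottedDiagram) : ℕ := D.word.countP Slice.isDot

/-- The split union: the second diagram is placed above the first one, so that a horizontal line
(hence a 2-sphere in space) separates the two. -/
def splitUnion (D E : DottedDiagram) : DottedDiagram where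
  word := D.word ++ E.word
  closed := by rw [run_append, D.closed]; exact E.closed

/-- The standard diagram of the unknot: a circle without crossings and without dots. -/
def unknot : DottedDiagram where
  word := [.cup 0, .cap 0]
  closed := by simp [run, Slice.pos, Slice.ins, Slice.outs]

end DottedDiagram

/-! ### Isotopy of (marked) links -/

/-- The local moves for unoriented link diagrams in general position with respect to height (planar
isotopies and the Reidemeister moves), and the moves for dots: a dot may slide along its component,
and two dots next to each other on the same component cancel. -/
inductive LocalMove : List Slice → List Slice → Prop
  /-- Two events, the second one entirely to the right of the first one, change heights. -/
  | far (s t : Slice) (h : s.pos ≤ t.pos) :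
      LocalMove [s, t.shift s.outs] [t.shift s.ins, s]
  /-- A minimum and a maximum that are adjacent on a strand cancel. -/
  | zigzag_left (i : ℕ) : LocalMove [.cup i, .cap (i + 1)] []
  | zigzag_right (i : ℕ) : LocalMove [.cup (i + 1), .cap i] []
  /-- A crossing is turned around a minimum or a maximum. -/
  | turn_cup (b : Bool) (i : ℕ) :
      LocalMove [.cup i, .crossing b (i + 1)] [.cup (i + 1), .crossing (!b) i]
  | turn_cap (b : Bool) (i : ℕ) :
      LocalMove [.crossing b (i + 1), .cap i] [.crossing (!b) i, .cap (i + 1)]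
  /-- The first Reidemeister move. -/
  | reidemeister_one_cup (b : Bool) (i : ℕ) : LocalMove [.cup i, .crossing b i] [.cup i]
  | reidemeister_one_cap (b : Bool) (i : ℕ) : LocalMove [.crossing b i, .cap i] [.cap i]
  /-- The second Reidemeister move. -/
  | reidemeister_two (b : Bool) (i : ℕ) : LocalMove [.crossing b i, .crossing (!b) i] []
  /-- The third Reidemeister move. -/
  | reidemeister_three (b : Bool) (i : ℕ) :
      LocalMove [.crossing b i, .crossing b (i + 1), .crossing b i]
        [.crossing b (i + 1), .crossing b i, .crossing b (i + 1)]
  /-- Dots slide along the strands and cancel in pairs. -/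
  | dot_dot (i : ℕ) : LocalMove [.dot i, .dot i] []
  | dot_cup (i : ℕ) : LocalMove [.cup i, .dot i] [.cup i, .dot (i + 1)]
  | dot_cap (i : ℕ) : LocalMove [.dot i, .cap i] [.dot (i + 1), .cap i]
  | dot_crossing_left (b : Bool) (i : ℕ) :
      LocalMove [.dot i, .crossing b i] [.crossing b i, .dot (i + 1)]
  | dot_crossing_right (b : Bool) (i : ℕ) :
      LocalMove [.dot (i + 1), .crossing b i] [.crossing b i, .dot i]

/-- `E` arises from `D` by one local move. -/
def DottedDiagram.Step (D E : DottedDiagram) : Prop :=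
  ∃ u v r r' : List Slice,
    LocalMove r r' ∧ D.word = u ++ r ++ v ∧ E.word = u ++ r' ++ v

/-- Unoriented links in the 3-sphere with marked components, up to ambient isotopy: dotted diagrams
up to the equivalence relation generated by the local moves. A component is marked (has the value
`1`) if it carries an odd number of dots. Those with an even number of dots are the two-fold marked
links, the others the odd-marked links. -/
def MarkedLink : Type := Quot DottedDiagram.Step

/-- The marked link that a dotted diagram represents. -/
def DottedDiagram.markedLink (D : DottedDiagram) : MarkedLink := Quot.mk _ D

/-- Link diagrams: diagrams without dots. -/
def LinkDiagram : Type := {D : DottedDiagram // D.numDots = 0}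

/-- Unoriented links in the 3-sphere up to ambient isotopy: link diagrams up to the equivalence
relation generated by the local moves. -/
def Link : Type := Quot fun D E : LinkDiagram => D.1.Step E.1

/-- The link that a link diagram represents. -/
def LinkDiagram.link (D : LinkDiagram) : Link := Quot.mk _ D

/-- A link with the trivial two-fold marking data. -/
def Link.trivialMarking : Link → MarkedLink := Quot.map Subtype.val fun _ _ h => h

/-! ### Components and determinant -/

namespace DottedDiagram

variable (D : DottedDiagram)

/-- The points of a diagram at the heights between consecutive events: `(k, i)` is the point of the
strand `i` just above the first `k` events. -/
def Point : Type :=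
  {x : ℕ × ℕ // ∃ n, run 0 (D.word.take x.1) = some n ∧ x.2 < n}

/-- Two points are consecutive on a strand, and the piece of the strand between them does not pass
under a crossing. -/
inductive Joined : ℕ × ℕ → ℕ × ℕ → Prop
  | left (k : ℕ) (s : Slice) (j : ℕ) (hs : D.word[k]? = some s) (hj : j < s.pos) :
      Joined (k, j) (k + 1, j)
  | right (k : ℕ) (s : Slice) (j : ℕ) (hs : D.word[k]? = some s) (hj : s.pos ≤ j) :
      Joined (k, j + s.ins) (k + 1, j + s.outs)
  | cup (k i : ℕ) (hs : D.word[k]? = some (.cup i)) : Joined (k + 1, i) (k + 1, i + 1)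
  | cap (k i : ℕ) (hs : D.word[k]? = some (.cap i)) : Joined (k, i) (k, i + 1)
  | dot (k i : ℕ) (hs : D.word[k]? = some (.dot i)) : Joined (k, i) (k + 1, i)
  | over_true (k i : ℕ) (hs : D.word[k]? = some (.crossing true i)) :
      Joined (k, i) (k + 1, i + 1)
  | over_false (k i : ℕ) (hs : D.word[k]? = some (.crossing false i)) :
      Joined (k, i + 1) (k + 1, i)

/-- `Under x y o`: the piece of strand between the consecutive points `x` and `y` passes under a
crossing whose overstrand contains the point `o`. -/
inductive Under : ℕ × ℕ → ℕ × ℕ → ℕ × ℕ → Prop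
  | under_true (k i : ℕ) (hs : D.word[k]? = some (.crossing true i)) :
      Under (k, i + 1) (k + 1, i) (k, i)
  | under_false (k i : ℕ) (hs : D.word[k]? = some (.crossing false i)) :
      Under (k, i) (k + 1, i + 1) (k, i + 1)

/-- The number of components of the link. -/
noncomputable def numComponents : ℕ :=
  Nat.card (Quot fun x y : D.Point => D.Joined x.1 y.1 ∨ ∃ o, D.Under x.1 y.1 o)

/-- The relations between the points of a diagram in its Fox colouring group: points on the same
overpassing arc are equal, and `x + y = 2 o` when the arcs of `x` and `y` meet under the arc of `o`
at a crossing. -/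
noncomputable def colouringRelations : AddSubgroup (D.Point →₀ ℤ) :=
  AddSubgroup.closure
    ({z | ∃ x y : D.Point, D.Joined x.1 y.1 ∧
        z = Finsupp.single x 1 - Finsupp.single y 1} ∪
      {z | ∃ x y o : D.Point, D.Under x.1 y.1 o.1 ∧
        z = Finsupp.single x 1 + Finsupp.single y 1 - 2 • Finsupp.single o 1})

/-- The formal sums of points with total coefficient zero. -/
noncomputable def degreeZero : AddSubgroup (D.Point →₀ ℤ) :=
  (Finsupp.liftAddHom fun _ : D.Point => AddMonoidHom.id ℤ).ker

/-- The determinant of the link: the order of the reduced Fox colouring group, which is the first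
homology group of the double cover of the 3-sphere branched along the link. It is `0` if that group
is infinite. (For an additive subgroup `K` and a subgroup `H`, `H.relIndex K` is the order of
`K / (H ∩ K)`, or `0` if that is infinite.) -/
noncomputable def det : ℕ := D.colouringRelations.relIndex D.degreeZero

end DottedDiagram

/-- The diagram represents a knot, a link with exactly one component. -/
def LinkDiagram.IsKnot (D : LinkDiagram) : Prop := D.1.numComponents = 1

/-- The determinant of the link represented by a link diagram. -/
noncomputable def LinkDiagram.det (D : LinkDiagram) : ℕ := D.1.det

/-! ### Two-fold quasi-alternating links -/

/-- The two smoothings of a crossing. One consists of two vertical strands, the other of a maximum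
below a minimum. The `0`-smoothing (`e = false`) joins the two regions swept out by the overstrand
when it is turned counterclockwise, the `1`-smoothing (`e = true`) joins the other two. -/
def smoothing (e b : Bool) (i : ℕ) : List Slice :=
  if b = e then [.cap i, .cup i] else []

/-- The set of two-fold quasi-alternating two-fold marked links: the smallest set that contains the
unknot with trivial marking and every link that splits into two odd-marked links, and that contains
the link of a two-fold marked diagram `D` whenever it contains the links of both smoothings `D₀`,
`D₁` of `D` at some crossing and `det D = det D₀ + det D₁`. The dots of `D` are carried along to
`D₀` and `D₁`. All members have an even number of dots. -/
inductive InQ2 : MarkedLink → Prop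
  | unknot : InQ2 DottedDiagram.unknot.markedLink
  | split (D E : DottedDiagram) (hD : Odd D.numDots) (hE : Odd E.numDots) :
      InQ2 (D.splitUnion E).markedLink
  | resolve (D D₀ D₁ : DottedDiagram) (u v : List Slice) (b : Bool) (i : ℕ)
      (heven : Even D.numDots)
      (hD : D.word = u ++ [.crossing b i] ++ v)
      (hD₀ : D₀.word = u ++ smoothing false b i ++ v)
      (hD₁ : D₁.word = u ++ smoothing true b i ++ v)
      (h₀ : InQ2 D₀.markedLink) (h₁ : InQ2 D₁.markedLink)
      (hdet : D.det = D₀.det + D₁.det) :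
      InQ2 D.markedLink

/-- A link is TQA if it lies in the above set when it is given the trivial two-fold marking. -/
def Link.IsTQA (L : Link) : Prop := InQ2 L.trivialMarking

/-! ### The Kanenobu knots -/

/-- `|p|` half-twists of the vertical strands `i` and `i + 1`, with the handedness given by the sign
of `p`. -/
def halfTwists (i : ℕ) (p : ℤ) : List Slice :=
  List.replicate p.natAbs (.crossing (decide (0 < p)) i)

theorem run_halfTwists {n i : ℕ} (p : ℤ) (h : i + 2 ≤ n) : run n (halfTwists i p) = some n := by
  unfold halfTwists
  induction p.natAbs with
  | zero => rfl
  | succ m ih =>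
    have h2 : n - 2 + 2 = n := by omega
    simp [List.replicate_succ, run, Slice.pos, Slice.ins, Slice.outs, h, h2, ih]

/-- The events of the standard diagram of the Kanenobu knot `K_{p,q}`. It is symmetric about a
vertical axis, up to the half-twists: the right half (strands `4, …, 7`) and the left half (strands
`0, …, 3`) are mirror images, each being a 4-crossing diagram of the figure-eight knot (a clasp
between the strands `5`, `6`, then one crossing of the strands `4`, `5` below and one above the
first twist region). On the axis, between the strands `3` and `4`, there are, from bottom to top,
the connected sum (a maximum below a minimum), the `p` half-twists, and the `q` half-twists. -/
def kanenobuWord (p q : ℤ) : List Slice :=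
  [.cup 0, .cup 2, .cup 4, .cup 6] ++
  [.crossing true 5, .crossing true 5, .crossing false 1, .crossing false 1] ++
  [.cap 3, .cup 3] ++
  [.crossing false 4, .crossing true 2] ++
  halfTwists 3 p ++
  [.crossing false 4, .crossing true 2] ++
  halfTwists 3 q ++
  [.cap 5, .cap 1, .cap 2, .cap 0]

theorem run_kanenobuWord (p q : ℤ) : run 0 (kanenobuWord p q) = some 0 := by
  simp [kanenobuWord, run_append, run_halfTwists, run, Slice.pos, Slice.ins, Slice.outs]

/-- The standard diagram of the Kanenobu knot `K_{p,q}`. -/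
def kanenobu (p q : ℤ) : LinkDiagram :=
  ⟨⟨kanenobuWord p q, run_kanenobuWord p q⟩, by
    simp [DottedDiagram.numDots, kanenobuWord, halfTwists, List.countP_replicate, Slice.isDot]⟩

end TwoFold

namespace TwoFold

/-! ### Isotopies of words -/

/-! Fix one twist region of `K_{p,q}` and let the number `m` of its crossings grow. On a knot, two
dots can be created anywhere: put both next to each other, cancel or create them there, and slide
one along the knot. So the trivial marking may be drawn with one dot below and one dot above the
twist region. Resolve the topmost crossing. The vertical smoothing is the same knot with one
crossing fewer, and its two dots cancel again. In the horizontal smoothing the other crossings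
untwist under the new maximum, and the result is an unlink of two components with one dot on each,
which belongs to `InQ2` by the splitting rule and has determinant 0. Since all `K_{p,q}` have
determinant 25, the required equation is `25 = 25 + 0`. This is `Q2.replicate`. It is applied to the
`q` twists with `p = 0`, then to the `p` twists for arbitrary `q`. The induction starts at `4_1 #
4_1`, which is resolved by hand through Hopf link, trefoil and figure-eight factors.

Determinants and connectedness come from one device. Colours chosen freely at the minima propagate
upwards, and the only conditions left are the equalities at the maxima (`meets`). With the Fox
operation this presents the reduced colouring group as a quotient of `ℤ^r` (`det_eq_index`), so that
the determinant is that of an integer matrix, or 0 if a nonconstant integer colouring exists. With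
the operation `fun _ b => b` it decides whether the diagram has one component (`Connected`).
Isotopies are certified by explicit lists of moves, replayed by computation (`Isotopic.of_play`).

For infinitely many isotopy classes, the Kauffman bracket at `A = 2`, taken up to sign and powers of
two, is an isotopy invariant. For `K_{m,0}`, 17 times the bracket is `16^m n - (-1)^m c` with fixed
nonzero `n`, `c`. Its 2-part is bounded once `16^m > |c|`, so its odd part is unbounded
(`exists_lt_oddBracket`). -/

/-- One local move inside a word, between words that can be run from `n` strands alike. -/
def Slide (n : ℕ) (w w' : List Slice) : Prop :=
  run n w = run n w' ∧
    ∃ u v r r' : List Slice, LocalMove r r' ∧ w = u ++ r ++ v ∧ w' = u ++ r' ++ v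

/-- Isotopy of tangle diagrams with `n` strands at the bottom. -/
def Isotopic (n : ℕ) : List Slice → List Slice → Prop := Relation.EqvGen (Slide n)

namespace Isotopic

variable {n m : ℕ} {u v w a b : List Slice}

theorem refl (n : ℕ) (w : List Slice) : Isotopic n w w := Relation.EqvGen.refl w

theorem symm (h : Isotopic n u v) : Isotopic n v u := Relation.EqvGen.symm _ _ h

theorem trans (h : Isotopic n u v) (h' : Isotopic n v w) : Isotopic n u w := Relation.EqvGen.trans _ _ _ h h'

theorem context (ha : run m a = some n) (h : Isotopic n u v) (b : List Slice) :
    Isotopic m (a ++ u ++ b) (a ++ v ++ b) := by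
  induction h with
  | rel x y h =>
    obtain ⟨hr, p, q, r, r', hl, rfl, rfl⟩ := h
    refine .rel _ _ ⟨?_, a ++ p, q ++ b, r, r', hl, by simp, by simp⟩
    simp only [run_append, ha, Option.bind_some] at hr ⊢
    rw [hr]
  | refl x => exact .refl _ _
  | symm x y _ ih => exact ih.symm
  | trans x y z _ _ ih ih' => exact ih.trans ih'

theorem append_left (ha : run m a = some n) (h : Isotopic n u v) :
    Isotopic m (a ++ u) (a ++ v) := by
  simpa using h.context ha []

theorem append_right (h : Isotopic n u v) (b : List Slice) : Isotopic n (u ++ b) (v ++ b) :=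
  context (a := []) rfl h b

theorem run_eq (h : Isotopic n u v) : run n u = run n v := by
  induction h with
  | rel x y h => exact h.1
  | refl x => rfl
  | symm x y _ ih => exact ih.symm
  | trans x y z _ _ ih ih' => exact ih.trans ih'

theorem of_localMove {r r' : List Slice} (h : LocalMove r r') (hr : run n r = run n r') :
    Isotopic n r r' :=
  .rel _ _ ⟨hr, [], [], r, r', h, by simp, by simp⟩

/-- A local move can in principle create events on strands that do not exist. Because `Slide`
demands equal results of `run`, every intermediate word is closed too, and the whole chain stays
among dotted diagrams. -/
theorem markedLink_eq (h : Isotopic 0 u v) (hu : run 0 u = some 0) (hv : run 0 v = some 0) :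
    DottedDiagram.markedLink ⟨u, hu⟩ = DottedDiagram.markedLink ⟨v, hv⟩ := by
  induction h with
  | rel x y h => exact Quot.sound h.2
  | refl x => rfl
  | symm x y _ ih => exact (ih hv hu).symm
  | trans x y z hxy _ ih ih' =>
    have hy : run 0 y = some 0 := by rw [← run_eq hxy, hu]
    exact (ih hu hy).trans (ih' hy hv)

end Isotopic

/-! ### Certified isotopies: coded moves and their replay -/

/-- The same event in another position. -/
def Slice.place (j : ℕ) : Slice → Slice
  | .cup _ => .cup j
  | .cap _ => .cap j
  | .crossing b _ => .crossing b j
  | .dot _ => .dot j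

theorem Slice.shift_place (s : Slice) (j d : ℕ) : (s.place j).shift d = s.place (j + d) := by
  cases s <;> rfl

theorem Slice.place_pos (s : Slice) : s.place s.pos = s := by cases s <;> rfl

theorem Slice.pos_place (s : Slice) (j : ℕ) : (s.place j).pos = j := by cases s <;> rfl

/-- The exchange of distant events, phrased through the actual positions instead of shifts, so that
it can be tested and executed on a concrete word. -/
theorem LocalMove.far_right {s t : Slice} (h : s.pos + s.outs ≤ t.pos) :
    LocalMove [s, t] [t.place (t.pos - s.outs + s.ins), s] := by
  have h := LocalMove.far s (t.place (t.pos - s.outs)) (by rw [Slice.pos_place]; omega)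
  rwa [Slice.shift_place, Slice.shift_place, Nat.sub_add_cancel (by omega), Slice.place_pos] at h

theorem LocalMove.far_left {s t : Slice} (h : s.pos + s.ins ≤ t.pos) :
    LocalMove [s, t.place (t.pos - s.ins + s.outs)] [t, s] := by
  have h := LocalMove.far s (t.place (t.pos - s.ins)) (by rw [Slice.pos_place]; omega)
  rwa [Slice.shift_place, Slice.shift_place, Nat.sub_add_cancel (by omega), Slice.place_pos] at h

/-- Codes for the local moves, in both directions, the parameters being read off the word. -/
inductive Move : Type
  | right
  | left
  | cancel
  | create (s t : Slice)
  | untwist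
  | turn
  | braid
  | dot

/-- Whether two consecutive events cancel. -/
def cancels : Slice → Slice → Bool
  | .cup i, .cap j => j == i + 1 || i == j + 1
  | .crossing b i, .crossing c j => i == j && c == !b
  | .dot i, .dot j => i == j
  | _, _ => false

theorem LocalMove.of_cancels {s t : Slice} (h : cancels s t = true) : LocalMove [s, t] [] := by
  cases s <;> cases t <;> simp only [cancels, Bool.or_eq_true, Bool.and_eq_true, beq_iff_eq,
    Bool.false_eq_true] at h
  · rcases h with rfl | rfl
    · exact .zigzag_left _
    · exact .zigzag_right _
  · obtain ⟨rfl, rfl⟩ := h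
    exact .reidemeister_two _ _
  · subst h
    exact .dot_dot _

/-- The effect of a move on the first two events of a word. -/
def Move.pair : Move → Slice → Slice → Option (List Slice)
  | .right, s, t =>
    if s.pos + s.outs ≤ t.pos then some [t.place (t.pos - s.outs + s.ins), s] else none
  | .left, t, s =>
    if s.pos + s.ins ≤ t.pos then some [s, t.place (t.pos - s.ins + s.outs)] else none
  | .cancel, s, t => if cancels s t then some [] else none
  | .untwist, .cup i, .crossing _ j => if i = j then some [.cup i] else none
  | .untwist, .crossing _ i, .cap j => if i = j then some [.cap i] else none
  | .turn, .cup i, .crossing b j =>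
    if j = i + 1 then some [.cup (i + 1), .crossing (!b) i] else
    if i = j + 1 then some [.cup j, .crossing (!b) (j + 1)] else none
  | .turn, .crossing b i, .cap j =>
    if i = j + 1 then some [.crossing (!b) j, .cap (j + 1)] else
    if j = i + 1 then some [.crossing (!b) (i + 1), .cap i] else none
  | .dot, .cup i, .dot j =>
    if j = i then some [.cup i, .dot (i + 1)] else
    if j = i + 1 then some [.cup i, .dot i] else none
  | .dot, .dot j, .cap i =>
    if j = i then some [.dot (i + 1), .cap i] else
    if j = i + 1 then some [.dot i, .cap i] else none
  | .dot, .dot j, .crossing b i =>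
    if j = i then some [.crossing b i, .dot (i + 1)] else
    if j = i + 1 then some [.crossing b i, .dot i] else none
  | .dot, .crossing b i, .dot j =>
    if j = i then some [.dot (i + 1), .crossing b i] else
    if j = i + 1 then some [.dot i, .crossing b i] else none
  | _, _, _ => none

theorem Move.pair_sound (m : Move) (s t : Slice) (r : List Slice) (h : m.pair s t = some r) :
    LocalMove [s, t] r ∨ LocalMove r [s, t] := by
  unfold Move.pair at h
  split at h <;> (try split_ifs at h) <;> (try simp only [Option.some.injEq, reduceCtorEq] at h) <;>
    subst_vars
  · exact .inl (.far_right ‹_›)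
  · exact .inr (.far_left ‹_›)
  · exact .inl (.of_cancels ‹_›)
  · exact .inl (.reidemeister_one_cup _ _)
  · exact .inl (.reidemeister_one_cap _ _)
  · exact .inl (.turn_cup _ _)
  -- The turning move read backwards: starting it with `!b` produces `!(!b) = b` on the other side.
  · rename_i b j _
    exact .inr (by simpa using LocalMove.turn_cup (!b) j)
  · exact .inl (.turn_cap _ _)
  · rename_i b i _
    exact .inr (by simpa using LocalMove.turn_cap (!b) i)
  · exact .inl (.dot_cup _)
  · exact .inr (.dot_cup _)
  · exact .inl (.dot_cap _)
  · exact .inr (.dot_cap _)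
  · exact .inl (.dot_crossing_left _ _)
  · exact .inl (.dot_crossing_right _ _)
  · exact .inr (.dot_crossing_right _ _)
  · exact .inr (.dot_crossing_left _ _)

/-- The effect of a move at the beginning of a word. -/
def Move.act : Move → List Slice → Option (List Slice)
  | .create s t, w => if cancels s t then some (s :: t :: w) else none
  | .braid, .crossing b i :: .crossing c j :: .crossing d k :: w =>
    if b = c ∧ c = d ∧ i = k ∧ (j = i + 1 ∨ i = j + 1) then
      some (.crossing b j :: .crossing b i :: .crossing b j :: w) else none
  | m, s :: t :: w => (m.pair s t).map (· ++ w)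
  | _, _ => none

theorem Move.act_sound (m : Move) (w w' : List Slice) (h : m.act w = some w') :
    ∃ r r' v, (LocalMove r r' ∨ LocalMove r' r) ∧ w = r ++ v ∧ w' = r' ++ v := by
  unfold Move.act at h
  split at h
  · rename_i s t
    split_ifs at h with hc
    obtain rfl := Option.some.inj h
    exact ⟨[], [s, t], _, .inr (.of_cancels hc), rfl, rfl⟩
  · rename_i b i c j d k w
    split_ifs at h with hc
    obtain ⟨rfl, rfl, rfl, hj⟩ := hc
    obtain rfl := Option.some.inj h
    refine ⟨[.crossing b i, .crossing b j, .crossing b i],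
      [.crossing b j, .crossing b i, .crossing b j], w, ?_, rfl, rfl⟩
    rcases hj with rfl | rfl
    · exact .inl (.reidemeister_three _ _)
    · exact .inr (.reidemeister_three _ _)
  · obtain ⟨r, hr, rfl⟩ := Option.map_eq_some_iff.1 h
    exact ⟨_, r, _, Move.pair_sound _ _ _ r hr, rfl, rfl⟩
  · simp at h

/-- Perform a list of moves, each at a given place of the word. -/
def play (n : ℕ) : List (ℕ × Move) → List Slice → Option (List Slice)
  | [], w => some w
  | (k, m) :: l, w =>
    match m.act (w.drop k) with
    | some v => if run n w = run n (w.take k ++ v) then play n l (w.take k ++ v) else none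
    | none => none

/-- A list of moves is a certificate: `play` replays it and checks at each step that the result of
`run` is unchanged. The hypothesis holds by `rfl` on concrete words. -/
theorem Isotopic.of_play {n : ℕ} {w w' : List Slice} (l : List (ℕ × Move))
    (h : play n l w = some w') : Isotopic n w w' := by
  induction l generalizing w with
  | nil =>
    obtain rfl := Option.some.inj h
    exact .refl _ _
  | cons a l ih =>
    obtain ⟨k, m⟩ := a
    unfold play at h
    split at h
    · rename_i v hv
      split_ifs at h with hr
      refine .trans ?_ (ih h)
      obtain ⟨r, r', x, hl, hw, rfl⟩ := m.act_sound _ _ hv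
      have hw' : w = w.take k ++ r ++ x := by
        rw [List.append_assoc, ← hw, List.take_append_drop]
      rcases hl with hl | hl
      · exact .rel _ _ ⟨hr, w.take k, x, r, r', hl, hw', by simp⟩
      · exact .symm (.rel _ _ ⟨hr.symm, w.take k, x, r', r, hl, by simp, hw'⟩)
    · simp at h

/-! ### Colourings computed from bottom to top -/

/-- The number of minima of a word. -/
def numCups : List Slice → ℕ
  | [] => 0
  | .cup _ :: w => numCups w + 1
  | _ :: w => numCups w

theorem numCups_append (u v : List Slice) : numCups (u ++ v) = numCups u + numCups v := by
  induction u with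
  | nil => simp [numCups]
  | cons s u ih => cases s <;> simp [numCups, ih, add_right_comm]

section Colours

variable {X Y : Type*} (op : X → X → X) (e : ℕ → X)

/-- The colours of the strands above an event, given the colours of the strands below it and the
colour `x` of a new strand. An understrand of colour `b` becomes `op a b` when it passes under a
strand of colour `a`. -/
def Slice.colour (x : X) (f : ℕ → X) : Slice → ℕ → X
  | .cup i, j => if j < i then f j else if j < i + 2 then x else f (j - 2)
  | .cap i, j => if j < i then f j else f (j + 2)
  | .crossing true i, j =>
    if j = i then op (f i) (f (i + 1)) else if j = i + 1 then f i else f j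
  | .crossing false i, j =>
    if j = i then f (i + 1) else if j = i + 1 then op (f (i + 1)) (f i) else f j
  | .dot _, j => f j

variable {op} in
theorem Slice.colour_left (x : X) (f : ℕ → X) {s : Slice} {j : ℕ} (hj : j < s.pos) :
    s.colour op x f j = f j := by
  rcases s with i | i | ⟨_ | _, i⟩ | i <;> simp only [Slice.colour, Slice.pos] at hj ⊢ <;>
    grind

variable {op} in
theorem Slice.colour_right (x : X) (f : ℕ → X) {s : Slice} {j : ℕ} (hj : s.pos ≤ j) :
    s.colour op x f (j + s.outs) = f (j + s.ins) := by
  rcases s with i | i | ⟨_ | _, i⟩ | i <;> simp only [Slice.pos] at hj <;>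
    simp [Slice.colour, Slice.outs, Slice.ins] <;> grind

/-- The colours of the strands above a word; the minima get the colours `e c`, `e (c + 1)`, … -/
def colours : List Slice → ℕ → (ℕ → X) → ℕ → X
  | [], _, f => f
  | s :: w, c, f => colours w (c + numCups [s]) (s.colour op (e c) f)

/-- The pairs of colours that meet at the maxima of a word. -/
def meets : List Slice → ℕ → (ℕ → X) → List (X × X)
  | [], _, _ => []
  | .cap i :: w, c, f => (f i, f (i + 1)) :: meets w c ((Slice.cap i).colour op (e c) f)
  | s :: w, c, f => meets w (c + numCups [s]) (s.colour op (e c) f)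

theorem colours_append (u v : List Slice) (c : ℕ) (f : ℕ → X) :
    colours op e (u ++ v) c f = colours op e v (c + numCups u) (colours op e u c f) := by
  induction u generalizing c f with
  | nil => rfl
  | cons s u ih =>
    rw [List.cons_append, colours, ih, colours, ← List.singleton_append (l := u), numCups_append,
      add_assoc]

theorem meets_append (u v : List Slice) (c : ℕ) (f : ℕ → X) :
    meets op e (u ++ v) c f =
      meets op e u c f ++ meets op e v (c + numCups u) (colours op e u c f) := by
  induction u generalizing c f with
  | nil => rfl
  | cons s u ih =>
    rw [← List.singleton_append (l := u), numCups_append, ← add_assoc]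
    cases s <;> simp [meets, colours, ih, numCups]

theorem mem_meets {w : List Slice} {x : X × X} {c : ℕ} {f : ℕ → X} :
    x ∈ meets op e w c f ↔ ∃ k i, w[k]? = some (.cap i) ∧
      x = (colours op e (w.take k) c f i, colours op e (w.take k) c f (i + 1)) := by
  induction w generalizing c f with
  | nil => simp [meets]
  | cons s w ih =>
    have key : ∀ g : ℕ → X, (∃ k i, (s :: w)[k]? = some (.cap i) ∧
        x = (colours op e ((s :: w).take k) c f i, colours op e ((s :: w).take k) c f (i + 1))) ↔
        (∃ i, s = .cap i ∧ x = (f i, f (i + 1))) ∨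
          x ∈ meets op e w (c + numCups [s]) (s.colour op (e c) f) := by
      intro g
      rw [ih]
      constructor
      · rintro ⟨_ | k, i, h, hx⟩
        · exact .inl ⟨i, by simpa using h, hx⟩
        · exact .inr ⟨k, i, by simpa using h, hx⟩
      · rintro (⟨i, h, hx⟩ | ⟨k, i, h, hx⟩)
        · exact ⟨0, i, by simpa using h, hx⟩
        · exact ⟨k + 1, i, by simpa using h, hx⟩
    rw [key f]
    cases s <;> simp [meets, numCups]

-- Propagation is natural under homomorphisms of the operation. It transports colours computed in
-- `ℤ^r` to the abstract colouring group.
variable {op e} in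
theorem map_colours {op' : Y → Y → Y} (φ : X → Y) (hφ : ∀ a b, φ (op a b) = op' (φ a) (φ b))
    (w : List Slice) (c : ℕ) (f : ℕ → X) (j : ℕ) :
    φ (colours op e w c f j) = colours op' (φ ∘ e) w c (φ ∘ f) j := by
  induction w generalizing c f with
  | nil => rfl
  | cons s w ih =>
    rw [colours, colours, ih]
    congr 1
    funext j
    rcases s with i | i | ⟨_ | _, i⟩ | i <;> simp only [Slice.colour, Function.comp] <;>
      split_ifs <;> simp [hφ]

variable {op} in
theorem colours_const (hop : ∀ a, op a a = a) (x : X) (w : List Slice) (c : ℕ) :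
    colours op (fun _ => x) w c (fun _ => x) = fun _ => x := by
  induction w generalizing c with
  | nil => rfl
  | cons s w ih =>
    rw [colours]
    convert ih _ using 2
    funext j
    rcases s with i | i | ⟨_ | _, i⟩ | i <;> simp [Slice.colour, hop]

theorem colours_congr {e' : ℕ → X} (w : List Slice) (c : ℕ) (f : ℕ → X)
    (h : ∀ j, c ≤ j → j < c + numCups w → e j = e' j) :
    colours op e w c f = colours op e' w c f := by
  induction w generalizing c f with
  | nil => rfl
  | cons s w ih =>
    rw [← List.singleton_append, numCups_append] at h
    have h1 : s.colour op (e c) f = s.colour op (e' c) f := by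
      rcases s with i | i | ⟨_ | _, i⟩ | i <;> try rfl
      rw [h c le_rfl (by simp [numCups])]
    rw [colours, colours, h1, ih]
    intro j h1 h2
    exact h j (by omega) (by omega)

variable {D : DottedDiagram} (d : X)

/-- The computed colour of a point. -/
def DottedDiagram.colourAt (D : DottedDiagram) (x : ℕ × ℕ) : X :=
  colours op e (D.word.take x.1) 0 (fun _ => d) x.2

theorem DottedDiagram.colourAt_succ {k : ℕ} {s : Slice} (hs : D.word[k]? = some s) (j : ℕ) :
    D.colourAt op e d (k + 1, j) =
      s.colour op (e (numCups (D.word.take k))) (fun i => D.colourAt op e d (k, i)) j := by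
  have h : D.word.take (k + 1) = D.word.take k ++ [s] := by
    rw [List.take_add_one, hs]; rfl
  rw [colourAt, h, colours_append, zero_add]
  rfl

/-- Upward propagation satisfies every relation between consecutive points by construction, except
at a maximum, where two strands with independently computed colours meet. -/
theorem DottedDiagram.colourAt_of_joined {x y : ℕ × ℕ} (h : D.Joined x y) :
    D.colourAt op e d x = D.colourAt op e d y ∨
      (D.colourAt op e d x, D.colourAt op e d y) ∈ meets op e D.word 0 (fun _ => d) := by
  cases h with
  | left k s j hs hj =>
    left
    rw [colourAt_succ op e d hs, Slice.colour_left _ _ hj]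
  | right k s j hs hj =>
    left
    rw [colourAt_succ op e d hs, Slice.colour_right _ _ hj]
  | cup k i hs => left; simp [colourAt_succ op e d hs, Slice.colour]
  | cap k i hs => exact .inr ((mem_meets op e).2 ⟨k, i, hs, rfl⟩)
  | dot k i hs => left; simp [colourAt_succ op e d hs, Slice.colour]
  | over_true k i hs => left; simp [colourAt_succ op e d hs, Slice.colour]
  | over_false k i hs => left; simp [colourAt_succ op e d hs, Slice.colour]

theorem DottedDiagram.colourAt_of_under {x y o : ℕ × ℕ} (h : D.Under x y o) :
    D.colourAt op e d y = op (D.colourAt op e d o) (D.colourAt op e d x) := by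
  cases h with
  | under_true k i hs => simp [colourAt_succ op e d hs, Slice.colour]
  | under_false k i hs => simp [colourAt_succ op e d hs, Slice.colour]

/-- Whether a pair of numbers is a point of the diagram. -/
def DottedDiagram.IsPoint (D : DottedDiagram) (x : ℕ × ℕ) : Prop :=
  ∃ n, run 0 (D.word.take x.1) = some n ∧ x.2 < n

theorem DottedDiagram.exists_run_take {D : DottedDiagram} {k : ℕ} {s : Slice}
    (hs : D.word[k]? = some s) : ∃ n, run 0 (D.word.take k) = some n ∧ s.pos + s.ins ≤ n ∧
      run 0 (D.word.take (k + 1)) = some (n - s.ins + s.outs) := by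
  have h : D.word.take (k + 1) = D.word.take k ++ [s] := by
    rw [List.take_add_one, hs]; rfl
  have hw := D.closed
  rw [← List.take_append_drop (k + 1) D.word, run_append, h, run_append] at hw
  rw [h, run_append]
  cases hn : run 0 (D.word.take k) with
  | none => simp [hn] at hw
  | some n =>
    by_cases hp : s.pos + s.ins ≤ n
    · exact ⟨n, rfl, hp, by simp [run, hp]⟩
    · simp [hn, run, hp] at hw

/-- Uniqueness of propagation: a colouring that respects all relations is determined by its values
at the minima. The induction is on height; no strands, hence no points, exist at height 0 or above
the last event. -/
theorem DottedDiagram.eq_colourAt (cls : ℕ × ℕ → X)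
    (hj : ∀ x y, D.IsPoint x → D.IsPoint y → D.Joined x y → cls x = cls y)
    (hu : ∀ x y o, D.IsPoint x → D.IsPoint y → D.IsPoint o → D.Under x y o →
      cls y = op (cls o) (cls x))
    (he : ∀ k i, D.word[k]? = some (.cup i) → cls (k + 1, i) = e (numCups (D.word.take k)))
    {x : ℕ × ℕ} (hx : D.IsPoint x) : cls x = D.colourAt op e d x := by
  obtain ⟨k, j⟩ := x
  induction k generalizing j with
  | zero =>
    obtain ⟨n, hn, hlt⟩ := hx
    simp only [List.take_zero, run, Option.some.injEq] at hn hlt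
    omega
  | succ k ih =>
    cases hs : D.word[k]? with
    | none =>
      obtain ⟨n, hn, hlt⟩ := hx
      rw [List.getElem?_eq_none_iff] at hs
      simp only [List.take_of_length_le (Nat.le_succ_of_le hs), D.closed, Option.some.injEq] at hn
      omega
    | some s =>
      obtain ⟨n, hn, hle, hn'⟩ := exists_run_take hs
      have hlt : j < n - s.ins + s.outs := by
        obtain ⟨n', h1, h2⟩ := hx
        simp only [hn', Option.some.injEq] at h1
        omega
      have pt : ∀ i, i < n → D.IsPoint (k, i) := fun i hi => ⟨n, hn, hi⟩
      have pt' : ∀ i, i < n - s.ins + s.outs → D.IsPoint (k + 1, i) := fun i hi => ⟨_, hn', hi⟩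
      by_cases h1 : j < s.pos
      · have hJ := Joined.left (D := D) k s j hs h1
        rw [← hj _ _ (pt _ (by omega)) hx hJ, ih _ (pt _ (by omega))]
        rw [colourAt_succ op e d hs, Slice.colour_left _ _ h1]
      · by_cases h2 : s.pos + s.outs ≤ j
        · obtain ⟨j, rfl⟩ := Nat.exists_eq_add_of_le' (show s.outs ≤ j by omega)
          have hp : s.pos ≤ j := by omega
          have hlt' : j + s.ins < n := by omega
          rw [← hj _ _ (pt _ hlt') hx (.right k s j hs hp), ih _ (pt _ hlt'),
            colourAt_succ op e d hs, Slice.colour_right _ _ hp]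
        · rw [colourAt_succ op e d hs]
          rcases s with i | i | ⟨_ | _, i⟩ | i <;>
            simp only [Slice.pos, Slice.outs, Slice.ins, Slice.colour] at h1 h2 hlt pt' hle ⊢
          · rw [← he k i hs, if_neg h1, if_pos (by omega)]
            rcases (by omega : j = i ∨ j = i + 1) with rfl | rfl
            · rfl
            · exact (hj _ _ (pt' _ (by omega)) hx (.cup k i hs)).symm
          · omega
          · rcases (by omega : j = i ∨ j = i + 1) with rfl | rfl
            · rw [if_pos rfl, ← ih _ (pt _ (by omega))]
              exact (hj _ _ (pt _ (by omega)) hx (.over_false k j hs)).symm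
            · rw [if_neg (by omega), if_pos rfl, ← ih _ (pt _ (by omega)),
                ← ih _ (pt _ (by omega))]
              exact hu _ _ _ (pt _ (by omega)) hx (pt _ (by omega)) (.under_false k i hs)
          · rcases (by omega : j = i ∨ j = i + 1) with rfl | rfl
            · rw [if_pos rfl, ← ih _ (pt _ (by omega)), ← ih _ (pt _ (by omega))]
              exact hu _ _ _ (pt _ (by omega)) hx (pt _ (by omega)) (.under_true k j hs)
            · rw [if_neg (by omega), if_pos rfl, ← ih _ (pt _ (by omega))]
              exact (hj _ _ (pt _ (by omega)) hx (.over_true k i hs)).symm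
          · obtain rfl : j = i := by omega
            rw [← ih _ (pt _ (by omega))]
            exact (hj _ _ (pt _ (by omega)) hx (.dot k j hs)).symm

/-- Minima are indexed by the number of minima below them; this lemma and the following ones make
the indexing bijective. -/
theorem exists_cup {w : List Slice} {c : ℕ} (hc : c < numCups w) :
    ∃ k i, w[k]? = some (.cup i) ∧ numCups (w.take k) = c := by
  induction w generalizing c with
  | nil => simp [numCups] at hc
  | cons s w ih =>
    by_cases h : c < numCups [s]
    · cases s <;> simp [numCups] at h
      subst h
      exact ⟨0, _, rfl, rfl⟩
    · have hs := numCups_append [s] w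
      rw [List.singleton_append] at hs
      obtain ⟨k, i, h1, h2⟩ := ih (c := c - numCups [s]) (by omega)
      refine ⟨k + 1, i, by simpa using h1, ?_⟩
      rw [List.take_succ_cons, ← List.singleton_append, numCups_append]
      omega

theorem numCups_take_lt {w : List Slice} {k l i : ℕ} (hk : w[k]? = some (.cup i)) (hl : k < l) :
    numCups (w.take k) < numCups (w.take l) := by
  have h : w.take l = w.take k ++ [.cup i] ++ (w.take l).drop (k + 1) := by
    conv_lhs => rw [← List.take_append_drop (k + 1) (w.take l)]
    rw [List.take_take, min_eq_left hl, List.take_add_one, hk]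
    rfl
  rw [h, numCups_append, numCups_append]
  simp only [numCups]
  omega

theorem numCups_take_lt' {w : List Slice} {k i : ℕ} (hk : w[k]? = some (.cup i)) :
    numCups (w.take k) < numCups w := by
  simpa using numCups_take_lt hk (List.getElem?_eq_some_iff.1 hk).1

theorem eq_of_numCups_take_eq {w : List Slice} {k l i j : ℕ} (hk : w[k]? = some (.cup i))
    (hl : w[l]? = some (.cup j)) (h : numCups (w.take k) = numCups (w.take l)) :
    k = l ∧ i = j := by
  obtain rfl : k = l := by
    rcases lt_trichotomy k l with hkl | hkl | hkl
    · have := numCups_take_lt hk hkl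
      omega
    · exact hkl
    · have := numCups_take_lt hl hkl
      omega
  exact ⟨rfl, by simpa [hk] using hl⟩

theorem DottedDiagram.isPoint_cup {k i : ℕ} (h : D.word[k]? = some (.cup i)) :
    D.IsPoint (k + 1, i) := by
  obtain ⟨n, _, hle, hn⟩ := exists_run_take h
  exact ⟨_, hn, by simp only [Slice.pos, Slice.ins, Slice.outs] at hle ⊢; omega⟩

/-- A choice of a point on every minimum. -/
theorem DottedDiagram.exists_cupPoints (D : DottedDiagram) :
    ∃ P : ℕ → ℕ × ℕ, (∀ c < numCups D.word, D.IsPoint (P c)) ∧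
      (∀ k i, D.word[k]? = some (.cup i) → P (numCups (D.word.take k)) = (k + 1, i)) ∧
      ∀ c < numCups D.word, ∃ k i, D.word[k]? = some (.cup i) ∧
        numCups (D.word.take k) = c ∧ P c = (k + 1, i) := by
  choose k i hk hc using fun c : {c // c < numCups D.word} => exists_cup c.2
  refine ⟨fun c => if h : c < numCups D.word then (k ⟨c, h⟩ + 1, i ⟨c, h⟩) else 0, ?_, ?_, ?_⟩
  · intro c h
    simp only [h, dif_pos]
    exact isPoint_cup (hk _)
  · intro l j h
    simp only [numCups_take_lt' h, dif_pos]
    obtain ⟨h1, h2⟩ := eq_of_numCups_take_eq (hk ⟨_, numCups_take_lt' h⟩) h (hc _)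
    rw [h1, h2]
  · intro c h
    exact ⟨_, _, hk ⟨c, h⟩, hc _, by simp [h]⟩

end Colours

/-! ### The determinant as an index -/

namespace DottedDiagram

variable (D : DottedDiagram)

/-- The operation that defines Fox colourings. -/
def foxOp {M : Type*} [AddCommGroup M] (a b : M) : M := a + a - b

/-- The subgroup generated by the differences of the colours that meet at the maxima. -/
def meetSubgroup {M : Type*} [AddCommGroup M] (e : ℕ → M) (w : List Slice) : AddSubgroup M :=
  AddSubgroup.closure {z | ∃ x ∈ meets foxOp e w 0 (fun _ => 0), z = x.1 - x.2}

/-- The homomorphism that sends a point to its computed colour. -/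
noncomputable def colourHom {M : Type*} [AddCommGroup M] (e : ℕ → M) : (D.Point →₀ ℤ) →+ M :=
  Finsupp.liftAddHom fun x => (zmultiplesHom M) (D.colourAt foxOp e 0 x.1)

theorem colourHom_single {M : Type*} [AddCommGroup M] (e : ℕ → M) (x : D.Point) (n : ℤ) :
    D.colourHom e (Finsupp.single x n) = n • D.colourAt foxOp e 0 x.1 := by
  simp [colourHom]

/-- All relations hold for computed colours modulo the differences at the maxima, so the colour map
descends to the colouring group. -/
theorem colouringRelations_le {M : Type*} [AddCommGroup M] (e : ℕ → M) :
    D.colouringRelations ≤ (meetSubgroup e D.word).comap (D.colourHom e) := by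
  refine (AddSubgroup.closure_le _).2 ?_
  rintro z (⟨x, y, h, rfl⟩ | ⟨x, y, o, h, rfl⟩)
  · simp only [AddSubgroup.coe_comap, Set.mem_preimage, map_sub, colourHom_single, one_smul,
      SetLike.mem_coe]
    rcases D.colourAt_of_joined foxOp e 0 h with h | h
    · rw [h, sub_self]
      exact zero_mem _
    · exact AddSubgroup.subset_closure ⟨_, h, rfl⟩
  · simp only [AddSubgroup.coe_comap, Set.mem_preimage, map_sub, map_add, map_nsmul,
      colourHom_single, one_smul, SetLike.mem_coe, D.colourAt_of_under foxOp e 0 h]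
    rw [foxOp, show ∀ a b : M, a + (b + b - a) - 2 • b = 0 by intro a b; abel]
    exact zero_mem _

theorem single_sub_single_mem (x y : D.Point) :
    Finsupp.single x 1 - Finsupp.single y 1 ∈ D.degreeZero := by
  rw [degreeZero, AddMonoidHom.mem_ker, map_sub]
  simp

variable {D} in
theorem under_mem {x y o : D.Point} (h : D.Under x.1 y.1 o.1) :
    Finsupp.single x 1 + Finsupp.single y 1 - 2 • Finsupp.single o 1 ∈ D.colouringRelations :=
  AddSubgroup.subset_closure (.inr ⟨x, y, o, h, rfl⟩)

/-- The standard colours of the minima: zero for the first one, then the standard basis. -/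
def stdColour (r : ℕ) : ℕ → Fin r → ℤ := fun j c => if j = c + 1 then 1 else 0

/-- The minima generate the colouring group, and dividing by the class of the first one leaves
`ℤ^r`. The colour map `F` carries formal sums of degree zero onto `ℤ^r`, and such a sum is a
relation exactly when its image lies in `N`. Hence the two quotients have the same order. -/
theorem det_eq_index {r : ℕ} (hr : numCups D.word = r + 1) :
    D.det = (meetSubgroup (stdColour r) D.word).index := by
  obtain ⟨P, hP, hPc, hPk⟩ := D.exists_cupPoints
  let pt : (c : ℕ) → c < r + 1 → D.Point := fun c h => ⟨P c, hP c (hr ▸ h)⟩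
  have hval : ∀ c (h : c < r + 1), D.colourAt foxOp (stdColour r) 0 (pt c h).1 = stdColour r c := by
    intro c h
    obtain ⟨k, i, hk, hc, hPc⟩ := hPk c (hr ▸ h)
    simp only [pt, hPc]
    rw [colourAt_succ _ _ _ hk]
    simp [Slice.colour, hc]
  set N := meetSubgroup (stdColour r) D.word with hN
  set F := D.colourHom (stdColour r) with hF
  -- The minimum `c + 1` minus the minimum `0` has degree zero and maps to the basis vector `c`.
  have hsurj : D.degreeZero.map F = ⊤ := by
    refine eq_top_iff.2 fun m _ => ⟨∑ c : Fin r, m c • (Finsupp.single (pt (c + 1) (by omega)) 1 -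
      Finsupp.single (pt 0 (by omega)) 1), ?_, ?_⟩
    · exact sum_mem fun c _ => zsmul_mem (D.single_sub_single_mem _ _) _
    · simp only [map_sum, map_zsmul, map_sub, hF, colourHom_single, hval, one_smul]
      funext c
      simp [stdColour, Finset.sum_apply, Fin.val_inj]
  have hker : N.comap F ⊓ D.degreeZero ≤ D.colouringRelations := by
    classical
    -- Only the kernel of the quotient map matters, so the quotient is kept opaque.
    obtain ⟨Q, _, mk, hQ⟩ : ∃ (Q : Type) (_ : AddCommGroup Q) (mk : (D.Point →₀ ℤ) →+ Q),
        mk.ker = D.colouringRelations :=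
      ⟨_, inferInstance, QuotientAddGroup.mk' _, QuotientAddGroup.ker_mk' _⟩
    let p₀ : D.Point := pt 0 (by omega)
    let cls : ℕ × ℕ → Q := fun x =>
      if h : D.IsPoint x then mk (Finsupp.single ⟨x, h⟩ 1 - Finsupp.single p₀ 1) else 0
    have hcls : ∀ x : D.Point, cls x.1 = mk (Finsupp.single x 1 - Finsupp.single p₀ 1) :=
      fun x => dif_pos x.2
    have hmk : ∀ z ∈ D.colouringRelations, mk z = 0 := fun z hz => by
      rwa [← hQ] at hz
    -- A section of the colour map modulo relations: the basis vector `c` goes to the class of the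
    -- minimum `c + 1`, measured from the base point `p₀` on the minimum `0`.
    let S : (Fin r → ℤ) →+ Q :=
      { toFun := fun m => ∑ c, m c • cls (P (c + 1))
        map_zero' := by simp
        map_add' := by simp [add_smul, Finset.sum_add_distrib] }
    have hS : ∀ c < r + 1, S (stdColour r c) = cls (P c) := by
      rintro (_ | c) hc
      · have h1 : cls (P 0) = 0 := by
          rw [hcls p₀, sub_self, map_zero]
        rw [h1]
        simp [S, stdColour]
      · change ∑ d : Fin r, (if c + 1 = d + 1 then (1 : ℤ) else 0) • cls (P (d + 1)) = _
        rw [Finset.sum_eq_single (⟨c, by omega⟩ : Fin r)]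
        · simp
        · intro d _ hd
          rw [if_neg, zero_smul]
          rintro h
          exact hd (Fin.ext (by simp; omega))
        · simp
    have hjoin : ∀ x y, D.IsPoint x → D.IsPoint y → D.Joined x y → cls x = cls y := by
      intro x y hx hy h
      rw [hcls ⟨x, hx⟩, hcls ⟨y, hy⟩, ← sub_eq_zero, ← map_sub]
      refine hmk _ ?_
      rw [sub_sub_sub_cancel_right]
      exact AddSubgroup.subset_closure (.inl ⟨⟨x, hx⟩, ⟨y, hy⟩, h, rfl⟩)
    have hcol : ∀ x, D.IsPoint x → cls x = S (D.colourAt foxOp (stdColour r) 0 x) := by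
      intro x hx
      have h := D.eq_colourAt foxOp (S ∘ stdColour r) 0 cls hjoin (fun x y o hx hy ho h => ?_)
        (fun k i h => ?_) hx
      · rw [h]
        have h0 : (fun _ : ℕ => (0 : Q)) = S ∘ fun _ => 0 := by funext j; simp
        rw [colourAt, h0, colourAt,
          map_colours (op := foxOp) (op' := foxOp) S (fun a b => by simp [foxOp])]
      · rw [hcls ⟨x, hx⟩, hcls ⟨y, hy⟩, hcls ⟨o, ho⟩, foxOp, ← map_add, ← map_sub, ← sub_eq_zero,
          ← map_sub]
        refine hmk _ ?_
        have := D.under_mem (x := ⟨x, hx⟩) (y := ⟨y, hy⟩) (o := ⟨o, ho⟩) h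
        refine (congrArg (· ∈ D.colouringRelations) ?_).mp this
        abel
      · rw [Function.comp, hS _ (hr ▸ numCups_take_lt' h), hPc k i h]
    -- The two ends of a maximum are equal in `Q`, so `S` kills the generators of `N`.
    have hN0 : N ≤ S.ker := by
      refine (AddSubgroup.closure_le _).2 ?_
      rintro z ⟨x, hx, rfl⟩
      obtain ⟨k, i, hk, rfl⟩ := (mem_meets _ _).1 hx
      obtain ⟨n, hn, hlt, _⟩ := exists_run_take hk
      simp only [Slice.pos, Slice.ins] at hlt
      have h1 : D.IsPoint (k, i) := ⟨n, hn, by simp; omega⟩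
      have h2 : D.IsPoint (k, i + 1) := ⟨n, hn, by simp; omega⟩
      have h := hjoin _ _ h1 h2 (.cap k i hk)
      rw [hcol _ h1, hcol _ h2, ← sub_eq_zero, ← map_sub] at h
      exact h
    rintro z ⟨hz, hdeg⟩
    -- Both sides are additive, so it is enough to compare them on single points. In degree zero the
    -- base point term drops out.
    have hz' : mk z = S (F z) + (Finsupp.liftAddHom fun _ : D.Point => AddMonoidHom.id ℤ) z •
        mk (Finsupp.single p₀ 1) := by
      let G : (D.Point →₀ ℤ) →+ Q := S.comp F +
        ((smulAddHom ℤ Q).flip (mk (Finsupp.single p₀ 1))).comp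
          (Finsupp.liftAddHom fun _ : D.Point => AddMonoidHom.id ℤ)
      have : mk = G := by
        refine Finsupp.addHom_ext fun x n => ?_
        have h1 : mk (Finsupp.single x n) = n • mk (Finsupp.single x 1) := by
          rw [← map_zsmul]; simp
        simp only [G, AddMonoidHom.add_apply, AddMonoidHom.comp_apply, hF, colourHom_single,
          map_zsmul, ← hcol _ x.2, hcls]
        simp [h1, smul_sub]
      exact DFunLike.congr_fun this z
    rw [AddMonoidHom.mem_ker.1 hdeg, zero_smul, add_zero, AddMonoidHom.mem_ker.1 (hN0 hz)] at hz'
    rwa [← hQ]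
  have hle : D.colouringRelations ⊓ D.degreeZero = N.comap F ⊓ D.degreeZero :=
    le_antisymm (inf_le_inf_right _ (D.colouringRelations_le _)) (le_inf hker inf_le_right)
  rw [det, ← AddSubgroup.inf_relIndex_right, hle, AddSubgroup.inf_relIndex_right,
    AddSubgroup.relIndex_comap, hsurj, AddSubgroup.relIndex_top_right]

/-- A nonconstant integer colouring maps the sums of degree zero onto a nontrivial, hence infinite,
subgroup of `ℤ` and kills all relations. -/
theorem det_eq_zero (e : ℕ → ℤ) (he : ∀ x ∈ meets foxOp e D.word 0 (fun _ => 0), x.1 = x.2)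
    {a b : ℕ} (ha : a < numCups D.word) (hb : b < numCups D.word) (hab : e a ≠ e b) :
    D.det = 0 := by
  obtain ⟨P, hP, hPc, hPk⟩ := D.exists_cupPoints
  have hval : ∀ c, c < numCups D.word → D.colourAt foxOp e 0 (P c) = e c := by
    intro c h
    obtain ⟨k, i, hk, hc, hPc⟩ := hPk c h
    rw [hPc, colourAt_succ _ _ _ hk]
    simp [Slice.colour, hc]
  have hbot : meetSubgroup e D.word = ⊥ := by
    refine AddSubgroup.closure_eq_bot_iff.2 ?_
    rintro z ⟨x, hx, rfl⟩
    simp [he x hx]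
  have hle := D.colouringRelations_le e
  rw [hbot] at hle
  -- An infinite index is recorded as 0. The index of the kernel of the colouring is such a 0, and
  -- it divides the index of the smaller subgroup of relations.
  refine Nat.eq_zero_of_zero_dvd ?_
  have h := AddSubgroup.relIndex_dvd_of_le_left D.degreeZero hle
  rw [AddSubgroup.relIndex_comap, AddSubgroup.relIndex_bot_left] at h
  have hmem : e a - e b ∈ D.degreeZero.map (D.colourHom e) := by
    let pa : D.Point := ⟨P a, hP a ha⟩
    let pb : D.Point := ⟨P b, hP b hb⟩
    refine ⟨_, D.single_sub_single_mem pa pb, ?_⟩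
    rw [map_sub, colourHom_single, colourHom_single, hval a ha, hval b hb, one_smul, one_smul]
  have : Infinite (D.degreeZero.map (D.colourHom e)) := by
    refine Infinite.of_injective (fun n : ℤ => ⟨n • (e a - e b), zsmul_mem hmem n⟩) ?_
    intro m n h
    have h' : m * (e a - e b) = n * (e a - e b) := by simpa using congrArg Subtype.val h
    exact mul_right_cancel₀ (sub_ne_zero.2 hab) h'
  rwa [Nat.card_eq_zero_of_infinite] at h

/-- If the determinant is nonzero, the rows form a basis of a sublattice, whose index is the
determinant of the change of basis. Otherwise some `v ≠ 0` is orthogonal to all rows; pairing with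
`v` kills the lattice but takes the value `v ⬝ᵥ v ≠ 0`, so the index is infinite. -/
theorem _root_.AddSubgroup.index_closure_range {r : ℕ} (A : Matrix (Fin r) (Fin r) ℤ) :
    (AddSubgroup.closure (Set.range A)).index = A.det.natAbs := by
  by_cases hA : A.det = 0
  · obtain ⟨v, hv, hAv⟩ := Matrix.exists_mulVec_eq_zero_iff.2 hA
    rw [hA, Int.natAbs_zero]
    let φ : (Fin r → ℤ) →+ ℤ :=
      { toFun := fun x => x ⬝ᵥ v, map_zero' := zero_dotProduct v, map_add' := fun x y => add_dotProduct x y v }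
    have hle : AddSubgroup.closure (Set.range A) ≤ (⊥ : AddSubgroup ℤ).comap φ := by
      refine (AddSubgroup.closure_le _).2 ?_
      rintro _ ⟨i, rfl⟩
      exact congrFun hAv i
    refine Nat.eq_zero_of_zero_dvd ?_
    have h := AddSubgroup.index_dvd_of_le hle
    rw [AddSubgroup.index_comap, AddSubgroup.relIndex_bot_left] at h
    convert h
    symm
    have hmem : v ⬝ᵥ v ∈ φ.range := ⟨v, rfl⟩
    have hvv : v ⬝ᵥ v ≠ 0 := by simpa using hv
    have : Infinite φ.range := by
      refine Infinite.of_injective (fun n : ℤ => ⟨n • (v ⬝ᵥ v), zsmul_mem hmem n⟩) ?_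
      intro m n h
      have h' : m * (v ⬝ᵥ v) = n * (v ⬝ᵥ v) := by simpa using congrArg Subtype.val h
      exact mul_right_cancel₀ hvv h'
    exact Nat.card_eq_zero_of_infinite
  · have hli : LinearIndependent ℤ A := Matrix.linearIndependent_rows_of_det_ne_zero hA
    rw [← Submodule.span_int_eq_addSubgroupClosure, AddSubgroup.index]
    refine (Submodule.natAbs_det_basis_change (Pi.basisFun ℤ (Fin r)) _
      (Module.Basis.span hli)).symm.trans ?_
    rw [Module.Basis.det_apply]
    congr 1
    rw [← Matrix.det_transpose A]
    congr 1
    ext i j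
    rw [Module.Basis.toMatrix_apply, Function.comp_apply, Module.Basis.span_apply hli j]
    simp

/-- The determinant from a matrix of all the colour differences at the maxima but the last one. -/
theorem det_eq_natAbs {r : ℕ} (hr : numCups D.word = r + 1) (A : Matrix (Fin r) (Fin r) ℤ)
    (k : Fin r → ℤ)
    (hA : (meets foxOp (stdColour r) D.word 0 fun _ => 0).map (fun x => x.1 - x.2) =
      List.ofFn A ++ [∑ i, k i • A i]) :
    D.det = A.det.natAbs := by
  rw [D.det_eq_index hr, ← AddSubgroup.index_closure_range, meetSubgroup]
  congr 1
  have h : ∀ z, (∃ x ∈ meets foxOp (stdColour r) D.word 0 fun _ => 0, z = x.1 - x.2) ↔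
      z ∈ Set.range A ∨ z = ∑ i, k i • A i := by
    intro z
    have h := iff_of_eq (congrArg (z ∈ ·) hA)
    simp only [List.mem_map, List.mem_append, List.mem_singleton] at h
    refine Iff.trans ?_ (h.trans (or_congr_left List.mem_ofFn))
    simp only [eq_comm]
  refine le_antisymm ((AddSubgroup.closure_le _).2 ?_) (AddSubgroup.closure_mono ?_)
  · intro z hz
    rcases (h z).1 hz with hz | rfl
    · exact AddSubgroup.subset_closure hz
    · exact sum_mem fun i _ => zsmul_mem (AddSubgroup.subset_closure (Set.mem_range_self i)) _
  · exact fun z hz => (h z).2 (.inl hz)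

end DottedDiagram

/-! ### Two-fold quasi-alternating words -/

/-- The word is a diagram of determinant `d`. -/
def HasDet (w : List Slice) (d : ℕ) : Prop :=
  ∃ h : run 0 w = some 0, DottedDiagram.det ⟨w, h⟩ = d

/-- The word is a diagram of a two-fold quasi-alternating marked link. -/
def Q2 (w : List Slice) : Prop :=
  ∃ h : run 0 w = some 0, InQ2 (DottedDiagram.markedLink ⟨w, h⟩)

/-- The form in which determinants are computed: `A` lists the differences at all maxima but the
last, and `k` exhibits the last one as a redundant combination of its rows. -/
theorem HasDet.of_matrix {w : List Slice} {r : ℕ} (A : Matrix (Fin r) (Fin r) ℤ) (k : Fin r → ℤ)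
    {d : ℕ} (hw : run 0 w = some 0) (hr : numCups w = r + 1)
    (hA : (meets DottedDiagram.foxOp (DottedDiagram.stdColour r) w 0 fun _ => 0).map
      (fun x => x.1 - x.2) = List.ofFn A ++ [∑ i, k i • A i])
    (hd : A.det.natAbs = d) : HasDet w d :=
  ⟨hw, (DottedDiagram.det_eq_natAbs ⟨w, hw⟩ hr A k hA).trans hd⟩

theorem HasDet.of_colouring {w : List Slice} (e : ℕ → ℤ) (hw : run 0 w = some 0)
    (he : ∀ x ∈ meets DottedDiagram.foxOp e w 0 (fun _ => 0), x.1 = x.2)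
    {a b : ℕ} (ha : a < numCups w) (hb : b < numCups w) (hab : e a ≠ e b) : HasDet w 0 :=
  ⟨hw, DottedDiagram.det_eq_zero ⟨w, hw⟩ e he ha hb hab⟩

namespace Q2

variable {u v w : List Slice}

theorem of_isotopic (h : Isotopic 0 u v) (hv : Q2 v) : Q2 u := by
  obtain ⟨hv, hq⟩ := hv
  have hu : run 0 u = some 0 := by rw [h.run_eq, hv]
  exact ⟨hu, by rwa [h.markedLink_eq hu hv]⟩

theorem unknot : Q2 [.cup 0, .cap 0] := ⟨rfl, InQ2.unknot⟩

/-- Two circles, one above the other, with one dot each: the only instance of the splitting rule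
that is needed. -/
theorem splitUnknots : Q2 [.cup 0, .dot 0, .cap 0, .cup 0, .dot 0, .cap 0] :=
  ⟨rfl, InQ2.split ⟨[.cup 0, .dot 0, .cap 0], rfl⟩ ⟨[.cup 0, .dot 0, .cap 0], rfl⟩
    (by decide) (by decide)⟩

/-- Here index 0 stands for the vertical and index 1 for the horizontal smoothing. Which of them is
the `0`-smoothing depends on `b`, but the determinant condition is symmetric. -/
theorem resolve {b : Bool} {i d₀ d₁ : ℕ} (heven : Even (w.countP Slice.isDot))
    (hw : w = u ++ [.crossing b i] ++ v)
    (h₀ : Q2 (u ++ v)) (h₁ : Q2 (u ++ [.cap i, .cup i] ++ v))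
    (hd : HasDet w (d₀ + d₁)) (hd₀ : HasDet (u ++ v) d₀)
    (hd₁ : HasDet (u ++ [.cap i, .cup i] ++ v) d₁) : Q2 w := by
  obtain ⟨hw0, hd⟩ := hd
  obtain ⟨h0, hd₀⟩ := hd₀
  obtain ⟨h1, hd₁⟩ := hd₁
  refine ⟨hw0, ?_⟩
  cases b
  · refine .resolve ⟨w, hw0⟩ ⟨_, h1⟩ ⟨_, h0⟩ u v false i heven hw (by simp [smoothing])
      (by simp [smoothing]) h₁.2 h₀.2 ?_
    rw [hd, hd₀, hd₁, add_comm]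
  · refine .resolve ⟨w, hw0⟩ ⟨_, h0⟩ ⟨_, h1⟩ u v true i heven hw (by simp [smoothing])
      (by simp [smoothing]) h₀.2 h₁.2 ?_
    rw [hd, hd₀, hd₁]

end Q2

/-! ### The connected sum of two figure-eight knots -/

/-- In this part the suffixes `_vertical` and `_horizontal` refer to the smoothings of the crossing
that is resolved next. The additions are `2 = 1 + 1`, `3 = 1 + 2`, `5 = 3 + 2`, and then, with one
figure-eight factor kept intact, `10 = 5 + 5`, `15 = 5 + 10`, `25 = 15 + 10`. -/
theorem hasDet_hopf : HasDet
    [.cup 0, .cup 2, .cap 1, .cup 1, .crossing true 2, .crossing true 2, .cap 1, .cap 0] 2 :=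
  .of_matrix !![-1, 0; 2, -2] ![1, 1] rfl rfl (by decide) (by decide)

theorem hasDet_hopf_vertical : HasDet
    [.cup 0, .cup 2, .cap 1, .cup 1, .crossing true 2, .cap 1, .cap 0] 1 :=
  .of_matrix !![-1, 0; 1, -1] ![1, 1] rfl rfl (by decide) (by decide)

theorem hasDet_hopf_horizontal : HasDet
    [.cup 0, .cup 2, .cap 1, .cup 1, .crossing true 2, .cap 2, .cup 2, .cap 1, .cap 0] 1 :=
  .of_matrix !![-1, 0, 0; -1, 1, 0; 0, 1, -1] ![1, -1, 1] rfl rfl (by decide) (by decide)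

/-- The Hopf link. -/
theorem q2_hopf : Q2
    [.cup 0, .cup 2, .cap 1, .cup 1, .crossing true 2, .crossing true 2, .cap 1, .cap 0] :=
  .resolve (u := [.cup 0, .cup 2, .cap 1, .cup 1, .crossing true 2])
    (v := [.cap 1, .cap 0]) (by decide) rfl
    (.of_isotopic (.of_play
      [(1, .cancel), (1, .turn), (2, .untwist), (1, .cancel)] rfl) Q2.unknot)
    (.of_isotopic (.of_play
      [(1, .cancel), (4, .cancel), (2, .untwist), (1, .cancel)] rfl) Q2.unknot)
    hasDet_hopf hasDet_hopf_vertical hasDet_hopf_horizontal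

theorem hasDet_trefoil : HasDet
    [.cup 0, .cup 2, .crossing false 1, .crossing true 2, .crossing true 2, .cap 1, .cap 0] 3 :=
  .of_matrix !![-3] ![1] rfl rfl (by decide) (by decide)

theorem hasDet_trefoil_vertical : HasDet
    [.cup 0, .cup 2, .crossing true 2, .crossing true 2, .cap 1, .cap 0] 1 :=
  .of_matrix !![-1] ![1] rfl rfl (by decide) (by decide)

theorem hasDet_trefoil_horizontal : HasDet
    [.cup 0, .cup 2, .cap 1, .cup 1, .crossing true 2, .crossing true 2, .cap 1, .cap 0] 2 :=
  .of_matrix !![-1, 0; 2, -2] ![1, 1] rfl rfl (by decide) (by decide)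

/-- The trefoil knot. -/
theorem q2_trefoil : Q2
    [.cup 0, .cup 2, .crossing false 1, .crossing true 2, .crossing true 2, .cap 1, .cap 0] :=
  .resolve (u := [.cup 0, .cup 2])
    (v := [.crossing true 2, .crossing true 2, .cap 1, .cap 0]) (by decide) rfl
    (.of_isotopic (.of_play
      [(1, .untwist), (1, .untwist), (1, .cancel)] rfl) Q2.unknot)
    q2_hopf
    hasDet_trefoil hasDet_trefoil_vertical hasDet_trefoil_horizontal

theorem hasDet_figureEight : HasDet
    [.cup 0, .cup 2, .crossing false 1, .crossing false 1, .crossing true 2, .crossing true 2,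
     .cap 1, .cap 0] 5 :=
  .of_matrix !![-5] ![1] rfl rfl (by decide) (by decide)

theorem hasDet_figureEight_vertical : HasDet
    [.cup 0, .cup 2, .crossing false 1, .crossing true 2, .crossing true 2, .cap 1, .cap 0] 3 :=
  .of_matrix !![-3] ![1] rfl rfl (by decide) (by decide)

theorem hasDet_figureEight_horizontal : HasDet
    [.cup 0, .cup 2, .crossing false 1, .cap 1, .cup 1, .crossing true 2, .crossing true 2,
     .cap 1, .cap 0] 2 :=
  .of_matrix !![-1, 0; 2, -2] ![1, 1] rfl rfl (by decide) (by decide)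

/-- The figure-eight knot. -/
theorem q2_figureEight : Q2
    [.cup 0, .cup 2, .crossing false 1, .crossing false 1, .crossing true 2, .crossing true 2,
     .cap 1, .cap 0] :=
  .resolve (u := [.cup 0, .cup 2, .crossing false 1])
    (v := [.crossing true 2, .crossing true 2, .cap 1, .cap 0]) (by decide) rfl
    q2_trefoil
    (.of_isotopic (.of_play
      [(2, .untwist)] rfl) q2_hopf)
    hasDet_figureEight hasDet_figureEight_vertical hasDet_figureEight_horizontal

theorem hasDet_figureEight_hopf : HasDet
    [.cup 0, .cup 2, .cup 3, .crossing false 1, .crossing false 1, .cup 3, .crossing false 4,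
     .crossing true 2, .crossing false 4, .crossing true 2, .cap 5, .cap 1, .cap 2, .cap 0] 10 :=
  .of_matrix !![0, 2, -2; -7, 0, 2; -1, 2, -1] ![1, 1, -1] rfl rfl (by decide) (by decide)

theorem hasDet_figureEight_hopf_vertical : HasDet
    [.cup 0, .cup 2, .cup 3, .crossing false 1, .crossing false 1, .cup 3, .crossing false 4,
     .crossing true 2, .crossing true 2, .cap 5, .cap 1, .cap 2, .cap 0] 5 :=
  .of_matrix !![0, 1, -1; -7, 0, 2; -1, 1, 0] ![1, 1, -1] rfl rfl (by decide) (by decide)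

theorem hasDet_figureEight_hopf_horizontal : HasDet
    [.cup 0, .cup 2, .cup 3, .crossing false 1, .crossing false 1, .cup 3, .crossing false 4,
     .crossing true 2, .cap 4, .cup 4, .crossing true 2, .cap 5, .cap 1, .cap 2, .cap 0] 5 :=
  .of_matrix !![0, -1, 1, 0; 0, -1, 0, 1; -7, 0, 2, 0; -1, 0, 0, 1] ![-1, 1, 1, -1] rfl rfl (by decide) (by decide)

/-- The connected sum of a figure-eight knot and a Hopf link. -/
theorem q2_figureEight_hopf : Q2
    [.cup 0, .cup 2, .cup 3, .crossing false 1, .crossing false 1, .cup 3, .crossing false 4,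
     .crossing true 2, .crossing false 4, .crossing true 2, .cap 5, .cap 1, .cap 2, .cap 0] :=
  .resolve (u := [.cup 0, .cup 2, .cup 3, .crossing false 1, .crossing false 1, .cup 3, .crossing false 4, .crossing true 2])
    (v := [.crossing true 2, .cap 5, .cap 1, .cap 2, .cap 0]) (by decide) rfl
    (.of_isotopic (.of_play
      [(5, .turn), (8, .right), (7, .right), (6, .right), (5, .cancel), (2, .left), (3, .left),
       (4, .untwist), (7, .right), (6, .right), (5, .right), (4, .cancel)] rfl) q2_figureEight)
    (.of_isotopic (.of_play
      [(6, .left), (7, .untwist), (6, .right), (5, .cancel), (6, .left), (7, .cancel), (2, .left),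
       (3, .left), (7, .right), (6, .right), (5, .right), (4, .cancel)] rfl) q2_figureEight)
    hasDet_figureEight_hopf hasDet_figureEight_hopf_vertical hasDet_figureEight_hopf_horizontal

theorem hasDet_figureEight_trefoil : HasDet
    [.cup 0, .cup 2, .cup 4, .crossing true 3, .crossing false 1, .crossing false 1, .cup 3,
     .crossing false 4, .crossing true 2, .crossing false 4, .crossing true 2, .cap 5, .cap 1,
     .cap 2, .cap 0] 15 :=
  .of_matrix !![5, -3, -2; -7, 0, 2; 4, -3, -1] ![1, 1, -1] rfl rfl (by decide) (by decide)

theorem hasDet_figureEight_trefoil_vertical : HasDet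
    [.cup 0, .cup 2, .cup 4, .crossing false 1, .crossing false 1, .cup 3, .crossing false 4,
     .crossing true 2, .crossing false 4, .crossing true 2, .cap 5, .cap 1, .cap 2, .cap 0] 5 :=
  .of_matrix !![3, -1, -2; -7, 0, 2; 2, -1, -1] ![1, 1, -1] rfl rfl (by decide) (by decide)

theorem hasDet_figureEight_trefoil_horizontal : HasDet
    [.cup 0, .cup 2, .cup 4, .cap 3, .cup 3, .crossing false 1, .crossing false 1, .cup 3,
     .crossing false 4, .crossing true 2, .crossing false 4, .crossing true 2, .cap 5, .cap 1,
     .cap 2, .cap 0] 10 :=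
  .of_matrix !![1, -1, 0, 0; 0, 0, 2, -2; -7, 0, 0, 2; 0, -1, 2, -1] ![1, 1, 1, -1] rfl rfl (by decide) (by decide)

/-- The connected sum of a figure-eight knot and a trefoil knot. -/
theorem q2_figureEight_trefoil : Q2
    [.cup 0, .cup 2, .cup 4, .crossing true 3, .crossing false 1, .crossing false 1, .cup 3,
     .crossing false 4, .crossing true 2, .crossing false 4, .crossing true 2, .cap 5, .cap 1,
     .cap 2, .cap 0] :=
  .resolve (u := [.cup 0, .cup 2, .cup 4])
    (v := [.crossing false 1, .crossing false 1, .cup 3, .crossing false 4, .crossing true 2, .crossing false 4, .crossing true 2, .cap 5, .cap 1, .cap 2, .cap 0]) (by decide) rfl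
    (.of_isotopic (.of_play
      [(2, .left), (3, .left), (4, .left), (5, .left), (6, .left), (7, .left), (8, .left),
       (9, .cancel), (7, .left), (8, .left), (9, .untwist), (5, .left), (6, .left), (7, .left),
       (8, .untwist), (7, .right), (6, .right), (5, .right), (4, .cancel)] rfl) q2_figureEight)
    (.of_isotopic (.of_play
      [(2, .cancel)] rfl) q2_figureEight_hopf)
    hasDet_figureEight_trefoil hasDet_figureEight_trefoil_vertical hasDet_figureEight_trefoil_horizontal

theorem hasDet_figureEight_figureEight : HasDet
    [.cup 0, .cup 2, .cup 4, .crossing true 3, .crossing true 3, .crossing false 1,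
     .crossing false 1, .cup 3, .crossing false 4, .crossing true 2, .crossing false 4,
     .crossing true 2, .cap 5, .cap 1, .cap 2, .cap 0] 25 :=
  .of_matrix !![7, -5, -2; -7, 0, 2; 6, -5, -1] ![1, 1, -1] rfl rfl (by decide) (by decide)

theorem hasDet_figureEight_figureEight_vertical : HasDet
    [.cup 0, .cup 2, .cup 4, .crossing true 3, .crossing false 1, .crossing false 1, .cup 3,
     .crossing false 4, .crossing true 2, .crossing false 4, .crossing true 2, .cap 5, .cap 1,
     .cap 2, .cap 0] 15 :=
  .of_matrix !![5, -3, -2; -7, 0, 2; 4, -3, -1] ![1, 1, -1] rfl rfl (by decide) (by decide)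

theorem hasDet_figureEight_figureEight_horizontal : HasDet
    [.cup 0, .cup 2, .cup 4, .crossing true 3, .cap 3, .cup 3, .crossing false 1,
     .crossing false 1, .cup 3, .crossing false 4, .crossing true 2, .crossing false 4,
     .crossing true 2, .cap 5, .cap 1, .cap 2, .cap 0] 10 :=
  .of_matrix !![1, -1, 0, 0; 0, 0, 2, -2; -7, 0, 0, 2; 0, -1, 2, -1] ![1, 1, 1, -1] rfl rfl (by decide) (by decide)

/-- The connected sum of two figure-eight knots. -/
theorem q2_figureEight_figureEight : Q2
    [.cup 0, .cup 2, .cup 4, .crossing true 3, .crossing true 3, .crossing false 1,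
     .crossing false 1, .cup 3, .crossing false 4, .crossing true 2, .crossing false 4,
     .crossing true 2, .cap 5, .cap 1, .cap 2, .cap 0] :=
  .resolve (u := [.cup 0, .cup 2, .cup 4, .crossing true 3])
    (v := [.crossing false 1, .crossing false 1, .cup 3, .crossing false 4, .crossing true 2, .crossing false 4, .crossing true 2, .cap 5, .cap 1, .cap 2, .cap 0]) (by decide) rfl
    q2_figureEight_trefoil
    (.of_isotopic (.of_play
      [(3, .untwist), (2, .cancel)] rfl) q2_figureEight_hopf)
    hasDet_figureEight_figureEight hasDet_figureEight_figureEight_vertical hasDet_figureEight_figureEight_horizontal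

/-- Without crossings on the axis, the maximum of the connected sum cancels against a minimum, which
leaves the diagram treated just before. -/
theorem q2_kanenobu_zero_zero : Q2
    [.cup 0, .cup 2, .cup 4, .cup 6, .crossing true 5, .crossing true 5, .crossing false 1,
     .crossing false 1, .cap 3, .cup 3, .crossing false 4, .crossing true 2, .crossing false 4,
     .crossing true 2, .cap 5, .cap 1, .cap 2, .cap 0] :=
  .of_isotopic (.of_play
      [(2, .right), (7, .right), (6, .right), (5, .left), (4, .left), (3, .cancel)] rfl) q2_figureEight_figureEight

/-! ### Connected diagrams -/

/-- The word is a diagram of a knot: every colouring of the minima that is constant on strands is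
constant. -/
def Connected (w : List Slice) : Prop :=
  ∀ (X : Type) (e : ℕ → X) (d : X),
    (∀ x ∈ meets (fun _ b => b) e w 0 (fun _ => d), x.1 = x.2) → ∀ c < numCups w, e c = e 0

/-- Two points are consecutive on a strand. -/
def DottedDiagram.Adjacent (D : DottedDiagram) (x y : D.Point) : Prop :=
  D.Joined x.1 y.1 ∨ ∃ o, D.Under x.1 y.1 o

/-- `Connected` is applied to the universal colouring, by the set of components itself: all minima
get the same colour, hence all points do. -/
theorem DottedDiagram.eqvGen_of_connected {D : DottedDiagram} (h : Connected D.word)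
    (x y : D.Point) : Relation.EqvGen D.Adjacent x y := by
  classical
  obtain ⟨P, hP, hPc, hPk⟩ := D.exists_cupPoints
  let cls : ℕ × ℕ → Quot D.Adjacent := fun x => if h : D.IsPoint x then Quot.mk _ ⟨x, h⟩ else
    Quot.mk _ y
  have hcls : ∀ x : D.Point, cls x.1 = Quot.mk _ x := fun x => dif_pos x.2
  have hj : ∀ x y, D.IsPoint x → D.IsPoint y → D.Joined x y → cls x = cls y := by
    intro x y hx hy h
    rw [hcls ⟨x, hx⟩, hcls ⟨y, hy⟩]
    exact Quot.sound (.inl h)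
  have hcol := fun x (hx : D.IsPoint x) => D.eq_colourAt (fun _ b => b) (fun c => cls (P c))
    (cls (P 0)) cls hj (fun x y o hx hy ho h => by
      rw [hcls ⟨x, hx⟩, hcls ⟨y, hy⟩]
      exact (Quot.sound (.inr ⟨o, h⟩)).symm)
    (fun k i h => by rw [hPc k i h]) hx
  have he : ∀ c < numCups D.word, cls (P c) = cls (P 0) := by
    refine h _ _ (cls (P 0)) ?_
    intro x hx
    obtain ⟨k, i, hk, rfl⟩ := (mem_meets _ _).1 hx
    obtain ⟨n, hn, hlt, _⟩ := exists_run_take hk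
    simp only [Slice.pos, Slice.ins] at hlt
    have h1 : D.IsPoint (k, i) := ⟨n, hn, by simp; omega⟩
    have h2 : D.IsPoint (k, i + 1) := ⟨n, hn, by simp; omega⟩
    have h := hj _ _ h1 h2 (.cap k i hk)
    rwa [hcol _ h1, hcol _ h2] at h
  have hconst : ∀ x : D.Point, cls x.1 = cls (P 0) := by
    intro x
    rw [hcol x.1 x.2, DottedDiagram.colourAt, colours_congr (e' := fun _ => cls (P 0)),
      colours_const fun _ => rfl]
    intro j _ hj
    refine he j (hj.trans_le ?_)
    conv_rhs => rw [← List.take_append_drop x.1.1 D.word, numCups_append]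
    omega
  refine Quot.eqvGen_exact ?_
  rw [← hcls, ← hcls, hconst, hconst]

/-! ### Sliding dots along a knot -/

/-- A dot is put on a diagram at a given point. -/
def insertDot (w : List Slice) (x : ℕ × ℕ) : List Slice :=
  w.take x.1 ++ [.dot x.2] ++ w.drop x.1

theorem run_singleton {n : ℕ} {s : Slice} (h : s.pos + s.ins ≤ n) :
    run n [s] = some (n - s.ins + s.outs) := by
  rw [run, if_pos h, run]

theorem run_dot {n i : ℕ} (h : i < n) : run n [.dot i] = some n := by
  rw [run_singleton h]
  exact congrArg some (Nat.sub_add_cancel (by omega : 1 ≤ n))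

theorem run_dot_cons {n i : ℕ} (h : i < n) (w : List Slice) : run n (.dot i :: w) = run n w := by
  rw [← List.singleton_append, run_append, run_dot h, Option.bind_some]

theorem run_cons_dot {n i : ℕ} {s : Slice} (hs : s.pos + s.ins ≤ n) (h : i < n - s.ins + s.outs) :
    run n [s, .dot i] = run n [s] := by
  rw [← List.singleton_append, run_append, run_singleton hs, Option.bind_some, run_dot h]

theorem isotopic_dot_left {n j : ℕ} {s : Slice} (hj : j < s.pos) (hs : s.pos + s.ins ≤ n) :
    Isotopic n [.dot j, s] [s, .dot j] := by
  refine .of_localMove ?_ (by rw [run_dot_cons (by omega), run_cons_dot hs (by omega)])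
  have h := LocalMove.far (.dot j) (s.place (s.pos - 1)) (by
    rw [Slice.pos_place]; exact Nat.le_sub_one_of_lt hj)
  rwa [Slice.shift_place, Slice.shift_place, Slice.outs, Slice.ins, Nat.sub_add_cancel (by omega),
    Slice.place_pos] at h

theorem isotopic_dot_right {n j : ℕ} {s : Slice} (hj : s.pos ≤ j) (hn : j + s.ins < n) :
    Isotopic n [.dot (j + s.ins), s] [s, .dot (j + s.outs)] := by
  refine .symm (.of_localMove (.far s (.dot j) hj) ?_)
  rw [run_cons_dot (by omega) (by omega)]
  exact (run_dot_cons hn _).symm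

theorem DottedDiagram.isotopic_insertDot_succ (D : DottedDiagram) {k i j : ℕ} {s : Slice}
    (hs : D.word[k]? = some s)
    (h : ∀ n, run 0 (D.word.take k) = some n → s.pos + s.ins ≤ n → Isotopic n [.dot i, s] [s, .dot j]) :
    Isotopic 0 (insertDot D.word (k, i)) (insertDot D.word (k + 1, j)) := by
  obtain ⟨n, hn, hle, _⟩ := exists_run_take hs
  have hd : D.word.drop k = s :: D.word.drop (k + 1) := by
    rw [List.drop_eq_getElem_cons (List.getElem?_eq_some_iff.1 hs).1]
    congr 1
    exact (List.getElem?_eq_some_iff.1 hs).2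
  have ht : D.word.take (k + 1) = D.word.take k ++ [s] := by
    rw [List.take_add_one, hs]; rfl
  have := (h n hn hle).context hn (D.word.drop (k + 1))
  simpa [insertDot, hd, ht] using this

/-- Each kind of adjacency corresponds to one move of the inserted dot: past a distant event, around
a minimum or maximum, or through a crossing as part of the over- or understrand. -/
theorem DottedDiagram.isotopic_insertDot_of_adjacent {D : DottedDiagram} {x y : D.Point}
    (h : D.Adjacent x y) : Isotopic 0 (insertDot D.word x.1) (insertDot D.word y.1) := by
  obtain ⟨x, hx⟩ := x
  obtain ⟨y, hy⟩ := y
  simp only [Adjacent] at h ⊢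
  have cross : ∀ {n i j l : ℕ} {b : Bool}, i + 2 ≤ n → i ≤ j → j < i + 2 → i ≤ l → l < i + 2 →
      run n [.dot j, .crossing b i] = run n [.crossing b i, .dot l] := by
    intro n i j l b h1 h2 h3 h4 h5
    rw [run_dot_cons (by omega), run_cons_dot (by exact h1)]
    simp only [Slice.ins, Slice.outs]
    omega
  rcases h with h | ⟨o, h⟩
  · cases h with
    | left k s j hs hj =>
      exact D.isotopic_insertDot_succ hs fun n _ hle => isotopic_dot_left hj hle
    | right k s j hs hj =>
      obtain ⟨n', hn', hlt⟩ := hx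
      refine D.isotopic_insertDot_succ hs fun n hn hle => isotopic_dot_right hj ?_
      simp only at hn' hlt
      rw [hn, Option.some.injEq] at hn'
      omega
    | cup k i hs =>
      obtain ⟨n, hn, hle, _⟩ := exists_run_take hs
      have ht : D.word.take (k + 1) = D.word.take k ++ [.cup i] := by
        rw [List.take_add_one, hs]; rfl
      have h : Isotopic n [.cup i, .dot i] [.cup i, .dot (i + 1)] := by
        refine .of_localMove (.dot_cup i) ?_
        simp only [Slice.pos, Slice.ins] at hle
        rw [run_cons_dot hle (by simp only [Slice.ins, Slice.outs]; omega),
          run_cons_dot hle (by simp only [Slice.ins, Slice.outs]; omega)]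
      simpa [insertDot, ht] using h.context hn (D.word.drop (k + 1))
    | cap k i hs =>
      obtain ⟨n, hn, hle, _⟩ := exists_run_take hs
      have hd : D.word.drop k = .cap i :: D.word.drop (k + 1) := by
        rw [List.drop_eq_getElem_cons (List.getElem?_eq_some_iff.1 hs).1]
        congr 1
        exact (List.getElem?_eq_some_iff.1 hs).2
      have h : Isotopic n [.dot i, .cap i] [.dot (i + 1), .cap i] := by
        refine .of_localMove (.dot_cap i) ?_
        simp only [Slice.pos, Slice.ins] at hle
        rw [run_dot_cons (by omega), run_dot_cons (by omega)]
      simpa [insertDot, hd] using h.context hn (D.word.drop (k + 1))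
    -- Next to an existing dot, inserting before or after it gives the same word.
    | dot k i hs => exact D.isotopic_insertDot_succ hs fun n _ _ => .refl _ _
    | over_true k i hs =>
      exact D.isotopic_insertDot_succ hs fun n _ hle => .of_localMove (.dot_crossing_left true i)
        (cross hle (by omega) (by omega) (by omega) (by omega))
    | over_false k i hs =>
      exact D.isotopic_insertDot_succ hs fun n _ hle => .of_localMove (.dot_crossing_right false i)
        (cross hle (by omega) (by omega) (by omega) (by omega))
  · cases h with
    | under_true k i hs =>
      exact D.isotopic_insertDot_succ hs fun n _ hle => .of_localMove (.dot_crossing_right true i)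
        (cross hle (by omega) (by omega) (by omega) (by omega))
    | under_false k i hs =>
      exact D.isotopic_insertDot_succ hs fun n _ hle => .of_localMove (.dot_crossing_left false i)
        (cross hle (by omega) (by omega) (by omega) (by omega))

theorem DottedDiagram.isotopic_insertDot {D : DottedDiagram} (h : Connected D.word)
    (x y : D.Point) : Isotopic 0 (insertDot D.word x.1) (insertDot D.word y.1) := by
  induction eqvGen_of_connected h x y with
  | rel x y h => exact isotopic_insertDot_of_adjacent h
  | refl x => exact .refl _ _
  | symm x y _ ih => exact ih.symm
  | trans x y z _ _ ih ih' => exact ih.trans ih'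

theorem DottedDiagram.numComponents_of_connected {D : DottedDiagram} (h : Connected D.word)
    (hD : D.word ≠ []) : D.numComponents = 1 := by
  rw [numComponents, Nat.card_eq_one_iff_unique]
  constructor
  · constructor
    rintro ⟨x⟩ ⟨y⟩
    exact Quot.eqvGen_sound (eqvGen_of_connected h x y)
  -- A component exists because the first event starts from no strands and can only be a minimum.
  · obtain ⟨s, w, hw⟩ := List.exists_cons_of_ne_nil hD
    have hs : D.word[0]? = some s := by rw [hw]; rfl
    obtain ⟨n, hn, hle, hn'⟩ := exists_run_take hs
    obtain rfl : n = 0 := by simpa [run] using hn.symm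
    have hcup : ∃ i, s = .cup i := by
      cases s <;> simp [Slice.pos, Slice.ins] at hle ⊢
    obtain ⟨i, rfl⟩ := hcup
    exact ⟨Quot.mk _ ⟨(1, i), isPoint_cup hs⟩⟩

theorem meets_dot {X : Type*} (op : X → X → X) (e : ℕ → X) (a b : List Slice) (i c : ℕ)
    (f : ℕ → X) : meets op e (a ++ [.dot i] ++ b) c f = meets op e (a ++ b) c f := by
  rw [List.append_assoc, meets_append, meets_append op e a b]
  rfl

theorem numCups_dot (a b : List Slice) (i : ℕ) :
    numCups (a ++ [.dot i] ++ b) = numCups (a ++ b) := by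
  rw [List.append_assoc, numCups_append, numCups_append, numCups_append a b]
  simp [numCups]

theorem Connected.dot {a b : List Slice} (h : Connected (a ++ b)) (i : ℕ) :
    Connected (a ++ [.dot i] ++ b) := by
  intro X e d he c hc
  rw [meets_dot] at he
  rw [numCups_dot] at hc
  exact h X e d he c hc

theorem run_eq_of_dot {a b : List Slice} {i n m : ℕ} (h : run n (a ++ [.dot i] ++ b) = some m) :
    run n (a ++ b) = some m ∧ ∃ k, run n a = some k ∧ i < k := by
  rw [List.append_assoc, run_append] at h
  rw [run_append]
  cases ha : run n a with
  | none => simp [ha] at h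
  | some k =>
    rw [ha, Option.bind_some] at h
    have hi : i < k := by
      by_contra hi
      have hi' : ¬ i + 1 ≤ k := hi
      simp [run, Slice.pos, Slice.ins, hi'] at h
    rw [List.singleton_append, run_dot_cons hi] at h
    exact ⟨h, k, rfl, hi⟩

/-- On a knot a pair of dots can be cancelled. -/
theorem Connected.isotopic_two_dots {a b c : List Slice} {i j : ℕ} (h : Connected (a ++ b ++ c))
    (hr : run 0 (a ++ [.dot i] ++ b ++ [.dot j] ++ c) = some 0) :
    Isotopic 0 (a ++ [.dot i] ++ b ++ [.dot j] ++ c) (a ++ b ++ c) := by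
  have hr' : run 0 (a ++ [.dot i] ++ (b ++ [.dot j] ++ c)) = some 0 := by simpa using hr
  obtain ⟨h1, k, hk, hik⟩ := run_eq_of_dot hr'
  have h1' : run 0 (a ++ b ++ [.dot j] ++ c) = some 0 := by simpa using h1
  obtain ⟨-, l, hl, hjl⟩ := run_eq_of_dot h1'
  -- The lower dot travels along the knot until it sits next to the upper one, where the two cancel.
  have key := DottedDiagram.isotopic_insertDot (D := ⟨a ++ b ++ [.dot j] ++ c, h1'⟩) (h.dot j)
    ⟨(a.length, i), k, by simpa using hk, hik⟩ ⟨((a ++ b).length, j), l, by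
      rw [← hl]
      simp only [List.append_assoc (a ++ b), List.take_left], hjl⟩
  have e1 : insertDot (a ++ b ++ [.dot j] ++ c) (a.length, i) =
      a ++ [.dot i] ++ b ++ [.dot j] ++ c := by
    simp [insertDot]
  have e2 : insertDot (a ++ b ++ [.dot j] ++ c) ((a ++ b).length, j) =
      a ++ b ++ [.dot j, .dot j] ++ c := by
    rw [insertDot, List.append_assoc (a ++ b), List.take_left, List.drop_left]
    simp
  simp only [e1, e2] at key
  refine key.trans ?_
  have hd : Isotopic l [.dot j, .dot j] [] :=
    .of_localMove (.dot_dot j) (by rw [run_dot_cons hjl, run_dot hjl]; rfl)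
  simpa using hd.context hl c

/-! ### Twist regions -/

theorem numCups_replicate (m i : ℕ) (b : Bool) :
    numCups (List.replicate m (.crossing b i)) = 0 := by
  induction m with
  | zero => rfl
  | succ m ih => rw [List.replicate_succ, numCups, ih]; simp

theorem meets_replicate {X : Type*} (op : X → X → X) (e : ℕ → X) (m i c : ℕ) (b : Bool)
    (f : ℕ → X) : meets op e (List.replicate m (.crossing b i)) c f = [] := by
  induction m generalizing c f with
  | zero => rfl
  | succ m ih => rw [List.replicate_succ, meets, ih]; simp

theorem colours_replicate_const {X : Type*} (op : X → X → X) (hop : ∀ a, op a a = a) (e : ℕ → X)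
    (m i c : ℕ) (b : Bool) (f : ℕ → X) (hf : f i = f (i + 1)) :
    colours op e (List.replicate m (.crossing b i)) c f = f := by
  induction m generalizing c with
  | zero => rfl
  | succ m ih =>
    rw [List.replicate_succ, colours]
    have h : Slice.colour op (e c) f (.crossing b i) = f := by
      funext j
      cases b <;> simp only [Slice.colour] <;> grind
    rw [h, ih]

/-- For the trivial operation a crossing just swaps two colours, so only the parity of `m` matters.
-/
theorem colours_replicate_snd {X : Type*} (e : ℕ → X) (m i c : ℕ) (b : Bool) (f : ℕ → X) :
    colours (fun _ b => b) e (List.replicate m (.crossing b i)) c f = f ∨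
      colours (fun _ b => b) e (List.replicate m (.crossing b i)) c f =
        fun j => if j = i then f (i + 1) else if j = i + 1 then f i else f j := by
  induction m generalizing c f with
  | zero => exact .inl rfl
  | succ m ih =>
    have h : Slice.colour (fun _ b => b) (e c) f (.crossing b i) =
        fun j => if j = i then f (i + 1) else if j = i + 1 then f i else f j := by
      funext j
      cases b <;> simp only [Slice.colour]
    rw [List.replicate_succ, colours, h]
    rcases ih (c + numCups [.crossing b i])
      (fun j => if j = i then f (i + 1) else if j = i + 1 then f i else f j) with h' | h'
    · exact .inr h'
    · left
      rw [h']
      funext j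
      simp
      grind

/-- A half-twist translates both colours by plus or minus their difference, and the difference
itself stays the same. -/
theorem colours_halfTwists {M : Type*} [AddCommGroup M] (e : ℕ → M) (i c : ℕ) (p : ℤ)
    (f : ℕ → M) : colours DottedDiagram.foxOp e (halfTwists i p) c f = fun j =>
      if j = i then f i + p • (f i - f (i + 1)) else
      if j = i + 1 then f (i + 1) + p • (f i - f (i + 1)) else f j := by
  have key : ∀ (b : Bool) (m : ℕ) (c : ℕ) (f : ℕ → M),
      colours DottedDiagram.foxOp e (List.replicate m (.crossing b i)) c f = fun j =>
        if j = i then f i + (if b then m else -m : ℤ) • (f i - f (i + 1)) else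
        if j = i + 1 then f (i + 1) + (if b then m else -m : ℤ) • (f i - f (i + 1)) else f j := by
    intro b m
    induction m with
    | zero =>
      intro c f
      funext j
      simp [colours]
      grind
    | succ m ih =>
      intro c f
      rw [List.replicate_succ, colours, ih]
      funext j
      rcases eq_or_ne j i with rfl | h1
      · cases b <;> simp [Slice.colour, DottedDiagram.foxOp] <;> module
      · rcases eq_or_ne j (i + 1) with rfl | h2
        · cases b <;> simp [Slice.colour, DottedDiagram.foxOp] <;> module
        · cases b <;> simp [Slice.colour, h1, h2]
  rw [halfTwists, key]
  have hp : (if decide (0 < p) then (p.natAbs : ℤ) else -(p.natAbs : ℤ)) = p := by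
    by_cases h : 0 < p
    · simp [h, h.le]
    · simp [h, abs_of_nonpos (not_lt.1 h)]
  rw [hp]

theorem isotopic_cup_replicate {n i : ℕ} (m : ℕ) (b : Bool) (h : i ≤ n) :
    Isotopic n ([.cup i] ++ List.replicate m (.crossing b i)) [.cup i] := by
  induction m with
  | zero => exact .refl _ _
  | succ m ih =>
    refine .trans ?_ ih
    have h1 : Isotopic n [.cup i, .crossing b i] [.cup i] := by
      refine .of_localMove (.reidemeister_one_cup b i) ?_
      have : n + 2 - 2 + 2 = n + 2 := by omega
      simp [run, Slice.pos, Slice.ins, Slice.outs, h]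
    simpa [List.replicate_succ] using h1.append_right (List.replicate m (.crossing b i))

theorem run_replicate {n i : ℕ} (m : ℕ) (b : Bool) (h : i + 2 ≤ n) :
    run n (List.replicate m (.crossing b i)) = some n := by
  induction m with
  | zero => rfl
  | succ m ih =>
    have h2 : n - 2 + 2 = n := by omega
    simp [List.replicate_succ, run, Slice.pos, Slice.ins, Slice.outs, h, h2, ih]

theorem isotopic_replicate_cap {n i : ℕ} (m : ℕ) (b : Bool) (h : i + 2 ≤ n) :
    Isotopic n (List.replicate m (.crossing b i) ++ [.cap i]) [.cap i] := by
  induction m with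
  | zero => exact .refl _ _
  | succ m ih =>
    refine .trans ?_ ih
    have h1 : Isotopic n [.crossing b i, .cap i] [.cap i] := by
      refine .of_localMove (.reidemeister_one_cap b i) ?_
      have : n - 2 + 2 = n := by omega
      simp [run, Slice.pos, Slice.ins, Slice.outs, h, this]
    simpa [List.replicate_succ'] using h1.append_left (run_replicate m b h)

/-! ### Kanenobu knots -/

/-- The part of the diagram of a Kanenobu knot below the first twist region. -/
def kanenobuBase : List Slice :=
  [.cup 0, .cup 2, .cup 4, .cup 6, .crossing true 5, .crossing true 5, .crossing false 1,
    .crossing false 1, .cap 3, .cup 3, .crossing false 4, .crossing true 2]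

/-- The part of the diagram of a Kanenobu knot between the twist regions. -/
def kanenobuMid : List Slice := [.crossing false 4, .crossing true 2]

/-- The part of the diagram of a Kanenobu knot above the second twist region. -/
def kanenobuTop : List Slice := [.cap 5, .cap 1, .cap 2, .cap 0]

theorem kanenobuWord_eq (p q : ℤ) : kanenobuWord p q =
    kanenobuBase ++ halfTwists 3 p ++ kanenobuMid ++ halfTwists 3 q ++ kanenobuTop := by
  simp [kanenobuWord, kanenobuBase, kanenobuMid, kanenobuTop]

theorem meets_halfTwists {X : Type*} (op : X → X → X) (e : ℕ → X) (i c : ℕ) (p : ℤ) (f : ℕ → X) :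
    meets op e (halfTwists i p) c f = [] :=
  meets_replicate ..

theorem numCups_halfTwists (i : ℕ) (p : ℤ) : numCups (halfTwists i p) = 0 :=
  numCups_replicate ..

/-- Only the parity of `p` matters, which leaves two cases; `q` does not matter at all, because both
strands of the second twist region lead back to the same minimum on the axis. -/
theorem connected_kanenobuWord (p q : ℤ) : Connected (kanenobuWord p q) := by
  intro X e d he c hc
  rw [kanenobuWord_eq] at he hc
  have hc' : c < 5 := by
    simpa [numCups_halfTwists, numCups_append, kanenobuBase, kanenobuMid, kanenobuTop, numCups]
      using hc
  have key : ∀ g, colours (fun _ b => b) e (halfTwists 3 p) 5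
      (colours (fun _ b => b) e kanenobuBase 0 fun _ => d) = g →
      meets (fun _ b => b) e (kanenobuBase ++ halfTwists 3 p ++ kanenobuMid ++ halfTwists 3 q ++
        kanenobuTop) 0 (fun _ => d) =
        [(e 1, e 2), (g 4, g 6), (g 1, g 3), (e 4, g 7), (g 0, e 4)] := by
    rintro g rfl
    simp only [meets_append, colours_append, numCups_append, meets_halfTwists, numCups_halfTwists]
    rw [show 0 + (numCups kanenobuBase + 0) = 5 from rfl, show 0 + numCups kanenobuBase = 5 from rfl]
    generalize hg : colours (fun _ b => b) e (halfTwists 3 p) 5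
      (colours (fun _ b => b) e kanenobuBase 0 fun _ => d) = g
    have h2 : g 2 = e 4 ∧ g 5 = e 4 := by
      rcases colours_replicate_snd e p.natAbs 3 5 (decide (0 < p)) (colours (fun _ b => b) e
        kanenobuBase 0 fun _ => d) with h | h
      all_goals
        -- The strands 2 and 5 carry the colour of minimum 4, the one on the axis, and avoid the
        -- first twist region. `kanenobuMid` moves them to the positions 3 and 4.
        rw [← hg, halfTwists, h]
        exact ⟨rfl, rfl⟩
    have h3 : ∀ c, colours (fun _ b => b) e (halfTwists 3 q) c
        (colours (fun _ b => b) e kanenobuMid 5 g) = colours (fun _ b => b) e kanenobuMid 5 g :=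
      fun c => colours_replicate_const (fun _ b => b) (fun _ => rfl) e q.natAbs 3 c _ _
        (h2.1.trans h2.2.symm)
    rw [h3]
    simp [kanenobuBase, kanenobuMid, kanenobuTop, meets, colours, Slice.colour, numCups, h2]
  rcases colours_replicate_snd e p.natAbs 3 5 (decide (0 < p)) (colours (fun _ b => b) e
    kanenobuBase 0 fun _ => d) with h | h
  · rw [key _ h] at he
    have he' := he
    simp [kanenobuBase, colours, Slice.colour] at he'
    simp only [numCups] at he'
    interval_cases c <;> grind
  · rw [key _ h] at he
    have he' := he
    simp [kanenobuBase, colours, Slice.colour] at he'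
    simp only [numCups] at he'
    interval_cases c <;> grind

/-- Twisting adds multiples of the single vector `(3, -3, 2, 0)`: `-p`, `p` and `2q` times it in the
last three rows. This vector, the first row and the sum of the second and third rows are linearly
dependent, so `p` and `q` cancel from the determinant. -/
theorem hasDet_kanenobuWord (p q : ℤ) : HasDet (kanenobuWord p q) 25 := by
  rw [kanenobuWord_eq]
  refine .of_matrix (r := 4) !![1, -1, 0, 0; -3 * p, 7 + 3 * p, -5 - 2 * p, -2;
    -7 + 3 * p, -3 * p, 2 * p, 2; 6 * q, 6 - 6 * q, -5 + 4 * q, -1] ![1, 1, 1, -1]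
    (kanenobuWord_eq p q ▸ run_kanenobuWord p q) ?_ ?_ ?_
  · simp [numCups_halfTwists, numCups_append, kanenobuBase, kanenobuMid, kanenobuTop, numCups]
  · have hA : ∀ A : Matrix (Fin 4) (Fin 4) ℤ, List.ofFn A = [A 0, A 1, A 2, A 3] := fun _ => rfl
    simp only [meets_append, colours_append, numCups_append, meets_halfTwists, numCups_halfTwists,
      colours_halfTwists]
    simp only [kanenobuBase, kanenobuMid, kanenobuTop, meets, colours, Slice.colour, numCups,
      hA, List.map_cons, List.map_append, List.map_nil]
    simp only [List.cons_append, List.nil_append, List.append_nil, List.cons.injEq, and_true]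
    refine ⟨?_, ?_, ?_, ?_, ?_⟩ <;> funext c <;> fin_cases c <;>
      simp [DottedDiagram.stdColour, DottedDiagram.foxOp, Fin.sum_univ_succ] <;> ring
  · have h : Fin.succAbove (1 : Fin 4) (2 : Fin 3) = 3 := rfl
    simp [Matrix.det_succ_row_zero, Fin.sum_univ_succ, h]
    ring_nf
    rfl

theorem HasDet.dot {a b : List Slice} {d i : ℕ} (h : HasDet (a ++ b) d)
    (hc : numCups (a ++ b) ≠ 0) (hr : run 0 (a ++ [.dot i] ++ b) = some 0) :
    HasDet (a ++ [.dot i] ++ b) d := by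
  obtain ⟨h', hd⟩ := h
  obtain ⟨r, hr'⟩ := Nat.exists_eq_succ_of_ne_zero hc
  refine ⟨hr, ?_⟩
  rw [← hd, DottedDiagram.det_eq_index ⟨_, hr⟩ (r := r) ((numCups_dot a b i).trans hr'),
    DottedDiagram.det_eq_index ⟨_, h'⟩ hr']
  simp only [DottedDiagram.meetSubgroup, meets_dot]

theorem countP_isDot_replicate (m i : ℕ) (b : Bool) :
    (List.replicate m (.crossing b i)).countP Slice.isDot = 0 := by
  simp [List.countP_replicate, Slice.isDot]

/-- A family of knots that differ by the number of crossings in a twist region is two-fold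
quasi-alternating if they have the same determinant and if smoothing the twist region gives a
two-fold quasi-alternating link of determinant zero when dots are put on both sides of it. -/
theorem Q2.replicate {a c : List Slice} {i n d : ℕ} {b : Bool} (ha : run 0 a = some n)
    (hi : i + 2 ≤ n) (hac : (a ++ c).countP Slice.isDot = 0)
    (hconn : ∀ m, Connected (a ++ List.replicate m (.crossing b i) ++ c))
    (hdet : ∀ m, HasDet (a ++ List.replicate m (.crossing b i) ++ c) d)
    (hcups : numCups a ≠ 0)
    (hsmooth : Q2 (a ++ [.dot i, .cap i, .cup i, .dot i] ++ c))
    (hsmooth' : ∀ m, HasDet (a ++ [.dot i] ++ List.replicate m (.crossing b i) ++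
      [.cap i, .cup i] ++ ([.dot i] ++ c)) 0)
    (h0 : Q2 (a ++ c)) (m : ℕ) : Q2 (a ++ List.replicate m (.crossing b i) ++ c) := by
  induction m with
  | zero => simpa using h0
  | succ m ih =>
    have hrep : ∀ m, run n (List.replicate m (.crossing b i)) = some n :=
      fun m => run_replicate m b hi
    have hdot : run n [.dot i] = some n := run_dot (by omega)
    have hc : run n c = some 0 := by
      obtain ⟨h, -⟩ := h0
      rwa [run_append, ha] at h
    have hrun : ∀ m, run 0 (a ++ [.dot i] ++ List.replicate m (.crossing b i) ++ [.dot i] ++ c) =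
        some 0 := by
      intro m
      simp only [run_append, ha, Option.bind_some, hdot, hrep, hc]
    have hiso := fun m => (hconn m).isotopic_two_dots (hrun m)
    have hdet' : ∀ m, HasDet
        (a ++ [.dot i] ++ List.replicate m (.crossing b i) ++ [.dot i] ++ c) d := by
      intro m
      have hne : ∀ w, numCups (a ++ w) ≠ 0 := by
        intro w
        rw [numCups_append]
        omega
      refine .dot ?_ (by simp only [List.append_assoc]; exact hne _) (hrun m)
      have h := hdet m
      rw [List.append_assoc] at h
      rw [List.append_assoc]
      refine h.dot (hne _) ?_
      simp only [run_append, ha, Option.bind_some, hdot, hrep, hc]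
    -- Since the diagram is a knot, the trivial marking may be drawn with a dot on either side of
    -- the twist region.
    refine .of_isotopic (hiso (m + 1)).symm ?_
    refine .resolve (u := a ++ [.dot i] ++ List.replicate m (.crossing b i)) (v := [.dot i] ++ c)
      (b := b) (i := i) (d₀ := d) (d₁ := 0) ?_ ?_ ?_ ?_ (hdet' (m + 1)) ?_ (hsmooth' m)
    · simp only [List.countP_append, countP_isDot_replicate] at hac ⊢
      have h1 : List.countP Slice.isDot [.dot i] = 1 := rfl
      rw [h1, show a.countP Slice.isDot + 1 + 0 + 1 + c.countP Slice.isDot = 2 by omega]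
      exact even_two
    · simp [List.replicate_succ']
    · refine .of_isotopic ?_ ih
      simpa using hiso m
    -- Below the maximum of the horizontal smoothing the remaining `m` crossings untwist.
    · refine .of_isotopic ?_ hsmooth
      have h := (isotopic_replicate_cap m b hi).context
        (m := 0) (a := a ++ [.dot i]) (by simp [run_append, ha, hdot]) ([.cup i, .dot i] ++ c)
      simpa using h
    · simpa using hdet' m

theorem replicate_eq_halfTwists (m i : ℕ) (b : Bool) :
    List.replicate m (Slice.crossing b i) = halfTwists i (if b then m else -m) := by
  cases b
  · simp [halfTwists]
  · rcases m with _ | m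
    · rfl
    · simp [halfTwists]
      omega

/-! ### The smoothings of the twist regions -/

/-- The two arcs that face each other at a smoothed first twist region are pulled apart. -/
theorem isotopic_first_smoothing : Isotopic 6
    [.cup 3, .crossing false 4, .crossing true 2, .dot 3, .cap 3, .cup 3, .dot 3,
     .crossing false 4, .crossing true 2]
    [.dot 2, .cap 2, .cup 2, .dot 2, .cup 3] :=
  .of_play
    [(0, .turn), (2, .dot), (1, .left), (3, .turn), (2, .cancel), (0, .left), (1, .left),
     (4, .right), (3, .turn), (2, .right), (3, .turn), (4, .dot), (5, .cancel), (3, .left)] rfl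

/-- What remains is an unlink. -/
theorem isotopic_first_unlink : Isotopic 0
    [.cup 0, .cup 2, .cup 4, .cup 6, .crossing true 5, .crossing true 5, .crossing false 1,
     .crossing false 1, .cap 3, .dot 2, .cap 2, .cup 2, .dot 2, .cup 3, .cap 5, .cap 1, .cap 2,
     .cap 0]
    [.cup 0, .dot 0, .cap 0, .cup 0, .dot 0, .cap 0] :=
  .of_play
    [(13, .right), (12, .right), (11, .cancel), (12, .left), (13, .cancel), (2, .right),
     (7, .right), (6, .right), (5, .left), (4, .left), (3, .cancel), (4, .left), (6, .dot),
     (5, .left), (7, .turn), (8, .right), (7, .right), (6, .dot), (9, .right), (8, .turn),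
     (7, .cancel), (4, .dot), (3, .left), (5, .right), (4, .dot), (6, .turn), (7, .right),
     (6, .turn), (5, .cancel), (0, .right), (1, .right), (2, .right), (3, .right), (4, .right),
     (5, .cancel), (1, .left), (3, .left), (2, .left)] rfl

set_option maxRecDepth 10000 in
/-- The diagram with no crossings in the first and a smoothed second twist region is an unlink: one
component is first passed over the rest of the diagram. -/
theorem isotopic_second_unlink : Isotopic 0
    [.cup 0, .cup 2, .cup 4, .cup 6, .crossing true 5, .crossing true 5, .crossing false 1,
     .crossing false 1, .cap 3, .cup 3, .crossing false 4, .crossing true 2, .crossing false 4,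
     .crossing true 2, .dot 3, .cap 3, .cup 3, .dot 3, .cap 5, .cap 1, .cap 2, .cap 0]
    [.cup 0, .dot 0, .cap 0, .cup 0, .dot 0, .cap 0] :=
  .of_play
    [(17, .right), (16, .right), (19, .right), (18, .right), (17, .cancel), (2, .right),
     (7, .right), (6, .right), (5, .left), (4, .left), (3, .cancel), (15, .left), (16, .dot),
     (15, .left), (14, .left), (13, .left), (12, .left), (11, .left), (10, .left), (9, .left),
     (8, .left), (7, .left), (6, .left), (5, .left), (4, .left), (3, .left), (2, .left),
     (1, .left), (2, .right), (16, .create (.crossing true 0) (.crossing false 0)), (17, .turn),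
     (18, .right), (15, .left), (16, .left),
     (17, .create (.crossing true 2) (.crossing false 2)), (18, .turn), (19, .right),
     (14, .left), (15, .left), (16, .create (.crossing true 2) (.crossing false 2)), (17, .turn),
     (18, .right), (19, .right), (20, .right), (13, .left), (14, .left), (15, .dot),
     (16, .right), (17, .right), (18, .right), (19, .right), (12, .left), (13, .braid),
     (15, .right), (16, .right), (17, .right), (18, .right), (17, .turn), (16, .right),
     (17, .turn), (15, .right), (16, .right), (17, .turn), (11, .left), (12, .left), (13, .left),
     (14, .right), (15, .braid), (17, .left), (16, .turn), (15, .left), (16, .turn), (14, .left),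
     (15, .left), (16, .turn), (10, .left), (11, .braid), (13, .right), (14, .right),
     (15, .right), (16, .right), (15, .turn), (14, .right), (15, .turn), (13, .right),
     (14, .right), (15, .turn), (9, .left), (10, .left), (11, .left), (12, .right), (13, .braid),
     (15, .left), (14, .turn), (13, .left), (14, .turn), (12, .left), (13, .left), (14, .turn),
     (8, .left), (9, .left), (10, .turn), (11, .cancel), (10, .right), (11, .right),
     (12, .right), (11, .turn), (10, .right), (11, .turn), (9, .right), (10, .right),
     (11, .turn), (8, .right), (9, .right), (10, .right), (11, .turn), (7, .right), (8, .right),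
     (9, .braid), (11, .left), (10, .turn), (9, .left), (10, .turn), (8, .left), (9, .left),
     (10, .turn), (7, .left), (8, .left), (9, .left), (10, .turn), (10, .turn), (9, .right),
     (10, .turn), (8, .right), (9, .right), (10, .turn), (7, .right), (8, .right), (9, .right),
     (10, .turn), (6, .right), (7, .right), (8, .braid), (10, .left), (9, .turn), (8, .left),
     (9, .turn), (7, .left), (8, .left), (9, .turn), (6, .left), (7, .left), (8, .left),
     (9, .turn), (5, .left), (6, .left), (7, .braid), (9, .right), (4, .left), (5, .left),
     (6, .braid), (8, .right), (3, .left), (4, .turn), (5, .cancel), (4, .right), (5, .right),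
     (2, .left), (1, .dot), (0, .untwist), (2, .turn), (3, .untwist), (2, .cancel), (1, .left),
     (2, .dot), (1, .turn), (0, .right), (1, .turn), (2, .right), (3, .right), (4, .cancel),
     (2, .dot), (1, .turn), (0, .right), (1, .turn), (2, .right), (3, .cancel), (1, .right),
     (3, .turn), (2, .right), (3, .turn), (4, .cancel), (3, .turn), (2, .right), (3, .turn),
     (4, .cancel), (5, .right), (4, .right), (3, .right), (2, .cancel), (0, .dot), (4, .left),
     (3, .left), (2, .left)] rfl
-- Once the two arcs are pulled apart, the `q` crossings sit directly on a minimum and untwist, so a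
-- single unlinking works for every `q`.
theorem q2_first_smoothing (q : ℤ) : Q2 (kanenobuBase ++ [.dot 3, .cap 3, .cup 3, .dot 3] ++
    (kanenobuMid ++ halfTwists 3 q ++ kanenobuTop)) := by
  have h1 := isotopic_first_smoothing.context (m := 0)
    (a := [.cup 0, .cup 2, .cup 4, .cup 6, .crossing true 5, .crossing true 5, .crossing false 1,
      .crossing false 1, .cap 3]) rfl (halfTwists 3 q ++ kanenobuTop)
  have h2 := (isotopic_cup_replicate (n := 6) q.natAbs (decide (0 < q))
    (by decide : 3 ≤ 6)).context (m := 0)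
    (a := [.cup 0, .cup 2, .cup 4, .cup 6, .crossing true 5, .crossing true 5, .crossing false 1,
      .crossing false 1, .cap 3, .dot 2, .cap 2, .cup 2, .dot 2]) rfl kanenobuTop
  refine .of_isotopic (.trans ?_ (.trans h2 isotopic_first_unlink)) Q2.splitUnknots
  simpa [kanenobuBase, kanenobuMid, halfTwists] using h1

theorem q2_second_smoothing : Q2 (kanenobuBase ++ kanenobuMid ++
    [.dot 3, .cap 3, .cup 3, .dot 3] ++ kanenobuTop) :=
  .of_isotopic isotopic_second_unlink Q2.splitUnknots

/-! ### Nonconstant colourings of the smoothed diagrams -/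

theorem foxOp_self {M : Type*} [AddCommGroup M] (a : M) : DottedDiagram.foxOp a a = a :=
  add_sub_cancel_right a a

theorem hasDet_first_smoothing (m : ℕ) (b : Bool) (q : ℤ) :
    HasDet (kanenobuBase ++ [.dot 3] ++ List.replicate m (.crossing b 3) ++ [.cap 3, .cup 3] ++
      ([.dot 3] ++ (kanenobuMid ++ halfTwists 3 q ++ kanenobuTop))) 0 := by
  -- A nonconstant solution at the six minima that gives equal colours to the two strands of either
  -- twist region, which makes the crossings there invisible.
  let e : ℕ → ℤ := fun c => [0, 1, 1, 0, 6, -2].getD c 0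
  have hrun : run 0 kanenobuBase = some 8 := rfl
  refine .of_colouring e ?_ ?_ (a := 0) (b := 1) ?_ ?_ (by decide)
  · simp only [run_append, hrun, Option.bind_some, run_dot (by decide : 3 < 8),
      run_replicate m b (by decide : 3 + 2 ≤ 8), show run 8 [.cap 3, .cup 3] = some 8 from rfl,
      show run 8 kanenobuMid = some 8 from rfl, run_halfTwists q (by decide : 3 + 2 ≤ 8)]
    rfl
  · simp only [meets_append, colours_append, numCups_append, numCups_replicate, meets_replicate,
      meets_halfTwists, numCups_halfTwists]
    rw [colours_replicate_const _ foxOp_self _ _ _ _ _ _ (by decide), halfTwists,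
      colours_replicate_const _ foxOp_self _ _ _ _ _ _ (by decide)]
    decide
  · simp [numCups_append, numCups_replicate, numCups, kanenobuBase]
  · simp [numCups_append, numCups_replicate, numCups, kanenobuBase]

theorem hasDet_second_smoothing (m : ℕ) (b : Bool) :
    HasDet (kanenobuBase ++ kanenobuMid ++ [.dot 3] ++ List.replicate m (.crossing b 3) ++
      [.cap 3, .cup 3] ++ ([.dot 3] ++ kanenobuTop)) 0 := by
  -- As before, the two twisted strands have equal colours, so `m` does not enter.
  let e : ℕ → ℤ := fun c => [0, 2, 2, 0, 7, 0].getD c 0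
  have hrun : run 0 kanenobuBase = some 8 := rfl
  refine .of_colouring e ?_ ?_ (a := 0) (b := 1) ?_ ?_ (by decide)
  · simp only [run_append, hrun, Option.bind_some, run_dot (by decide : 3 < 8),
      run_replicate m b (by decide : 3 + 2 ≤ 8), show run 8 [.cap 3, .cup 3] = some 8 from rfl,
      show run 8 kanenobuMid = some 8 from rfl]
    rfl
  · simp only [meets_append, colours_append, numCups_append, numCups_replicate, meets_replicate]
    rw [colours_replicate_const _ foxOp_self _ _ _ _ _ _ (by decide)]
    decide
  · simp [numCups_append, numCups_replicate, numCups, kanenobuBase]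
  · simp [numCups_append, numCups_replicate, numCups, kanenobuBase]

/-- The order of the inductions is forced by the unlinkings at hand: the smoothed second region is
unlinked only for `p = 0`, the smoothed first region for all `q`. -/
theorem q2_kanenobuWord (p q : ℤ) : Q2 (kanenobuWord p q) := by
  have hmid : halfTwists 3 0 = [] := rfl
  have h0 : Q2 (kanenobuWord 0 q) := by
    have h := Q2.replicate (a := kanenobuBase ++ kanenobuMid) (c := kanenobuTop) (i := 3) (n := 8)
      (d := 25) (b := decide (0 < q)) rfl (by decide) (by decide) (fun m => ?_) (fun m => ?_)
      (by decide) q2_second_smoothing (fun m => hasDet_second_smoothing m _)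
      q2_kanenobu_zero_zero q.natAbs
    · rw [kanenobuWord_eq, hmid, List.append_nil]
      exact h
    · have h := connected_kanenobuWord 0 (if decide (0 < q) then m else -m)
      rwa [kanenobuWord_eq, hmid, List.append_nil, ← replicate_eq_halfTwists] at h
    · have h := hasDet_kanenobuWord 0 (if decide (0 < q) then m else -m)
      rwa [kanenobuWord_eq, hmid, List.append_nil, ← replicate_eq_halfTwists] at h
  have h := Q2.replicate (a := kanenobuBase) (c := kanenobuMid ++ halfTwists 3 q ++ kanenobuTop)
    (i := 3) (n := 8) (d := 25) (b := decide (0 < p)) rfl (by decide) ?_ (fun m => ?_)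
    (fun m => ?_) (by decide) (q2_first_smoothing q) (fun m => hasDet_first_smoothing m _ q) ?_
    p.natAbs
  · rw [kanenobuWord_eq]
    simpa [halfTwists] using h
  · simp only [List.countP_append, halfTwists, countP_isDot_replicate]
    decide
  · have h := connected_kanenobuWord (if decide (0 < p) then m else -m) q
    rw [kanenobuWord_eq, ← replicate_eq_halfTwists] at h
    simpa using h
  · have h := hasDet_kanenobuWord (if decide (0 < p) then m else -m) q
    rw [kanenobuWord_eq, ← replicate_eq_halfTwists] at h
    simpa using h
  · rw [kanenobuWord_eq, hmid] at h0
    simpa using h0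

/-! ### The Kauffman bracket at `A = 2`

A row of strands is coloured by a sequence of Booleans, and a tangle diagram acts on the integer
valued functions of such colourings. The action is normalised such that no denominators occur, and
local moves change it by a sign and a power of two only. -/

/-- Colourings of the strands at some height. -/
abbrev State : Type := ℕ → Bool

/-- Forget the colours of two adjacent strands. -/
def State.delete (i : ℕ) (x : State) : State := fun k => if k < i then x k else x (k + 2)

/-- Insert two adjacent strands with the colours `a` and `b`. -/
def State.insert (i : ℕ) (a b : Bool) (x : State) : State := fun k =>
  if k < i then x k else if k = i then a else if k = i + 1 then b else x (k - 2)

namespace State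

variable (i j : ℕ) (a b c d : Bool) (x : State)

theorem insert_self : insert i a b x i = a := by simp [insert]

theorem insert_succ : insert i a b x (i + 1) = b := by simp [insert]

theorem insert_of_lt {k : ℕ} (h : k < i) : insert i a b x k = x k := by simp [insert, h]

theorem insert_add_two {k : ℕ} (h : i ≤ k) : insert i a b x (k + 2) = x k := by
  grind [insert]

theorem delete_of_lt {k : ℕ} (h : k < i) : delete i x k = x k := by simp [delete, h]

theorem delete_of_le {k : ℕ} (h : i ≤ k) : delete i x k = x (k + 2) := by
  simp [delete, h.not_gt]

theorem delete_insert : delete i (insert i a b x) = x := by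
  funext k
  grind [insert, delete]

theorem delete_insert_succ (h : b = x i) : delete i (insert (i + 1) a b x) = x := by
  funext k
  grind [insert, delete]

theorem delete_succ_insert (h : a = x i) : delete (i + 1) (insert i a b x) = x := by
  funext k
  grind [insert, delete]

variable {i j}

theorem delete_insert_far (h : i ≤ j) :
    delete i (insert (j + 2) a b x) = insert j a b (delete i x) := by
  funext k
  grind [insert, delete]

theorem delete_far_insert (h : i ≤ j) :
    delete (j + 2) (insert i a b x) = insert i a b (delete j x) := by
  funext k
  grind [insert, delete]

theorem delete_delete_far (h : i ≤ j) : delete i (delete (j + 2) x) = delete j (delete i x) := by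
  funext k
  grind [delete]

theorem insert_insert_far (h : i ≤ j) :
    insert (j + 2) a b (insert i c d x) = insert i c d (insert j a b x) := by
  funext k
  grind [insert]

end State

/-- The weight of a minimum. -/
def cupWeight : Bool → Bool → ℤ
  | false, true => 1
  | true, false => -4
  | _, _ => 0

/-- The action of a minimum. -/
def cupOp (i : ℕ) : Module.End ℤ (State → ℤ) where
  toFun f x := cupWeight (x i) (x (i + 1)) * f (x.delete i)
  map_add' f g := by
    funext x
    simp only [Pi.add_apply]
    ring
  map_smul' c f := by
    funext x
    simp only [Pi.smul_apply, smul_eq_mul, RingHom.id_apply]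
    ring

/-- The action of a maximum. -/
def capOp (i : ℕ) : Module.End ℤ (State → ℤ) where
  toFun f x := 4 * f (x.insert i true false) - f (x.insert i false true)
  map_add' f g := by
    funext x
    simp only [Pi.add_apply]
    ring
  map_smul' c f := by
    funext x
    simp only [Pi.smul_apply, smul_eq_mul, RingHom.id_apply]
    ring

theorem cupOp_apply (i : ℕ) (f : State → ℤ) (x : State) :
    cupOp i f x = cupWeight (x i) (x (i + 1)) * f (x.delete i) := rfl

theorem capOp_apply (i : ℕ) (f : State → ℤ) (x : State) :
    capOp i f x = 4 * f (x.insert i true false) - f (x.insert i false true) := rfl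

/-- The loop value `-A² - A⁻²` at `A = 2` is `-17/4`. Multiplication by 4 clears the denominator,
which makes the straightening of a zigzag equal to 4 instead of 1. -/
theorem capOp_mul_cupOp (i : ℕ) : capOp i * cupOp i = (-17 : ℤ) • 1 := by
  ext f x
  simp only [Module.End.mul_apply, capOp_apply, cupOp_apply, State.insert_self, State.insert_succ,
    State.delete_insert, LinearMap.smul_apply, Module.End.one_apply, Pi.smul_apply, smul_eq_mul,
    cupWeight]
  ring

theorem capOp_succ_mul_cupOp (i : ℕ) : capOp (i + 1) * cupOp i = (4 : ℤ) • 1 := by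
  ext f x
  simp only [Module.End.mul_apply, capOp_apply, cupOp_apply, State.insert_self,
    State.insert_of_lt _ _ _ _ (Nat.lt_succ_self i), LinearMap.smul_apply, Module.End.one_apply,
    Pi.smul_apply, smul_eq_mul]
  cases h : x i
  · rw [State.delete_insert_succ i true false x h.symm]
    simp [cupWeight]
  · rw [State.delete_insert_succ i false true x h.symm]
    simp [cupWeight]

theorem capOp_mul_cupOp_succ (i : ℕ) : capOp i * cupOp (i + 1) = (4 : ℤ) • 1 := by
  ext f x
  simp only [Module.End.mul_apply, capOp_apply, cupOp_apply, State.insert_succ,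
    State.insert_add_two _ _ _ _ (le_refl i), LinearMap.smul_apply, Module.End.one_apply,
    Pi.smul_apply, smul_eq_mul, add_assoc, Nat.reduceAdd]
  cases h : x i
  · rw [State.delete_succ_insert i false true x h.symm]
    simp [cupWeight]
  · rw [State.delete_succ_insert i true false x h.symm]
    simp [cupWeight]

theorem cupOp_cupOp_far {i j : ℕ} (h : i ≤ j) : cupOp (j + 2) * cupOp i = cupOp i * cupOp j := by
  ext f x
  simp only [Module.End.mul_apply, cupOp_apply, State.delete_delete_far x h,
    State.delete_of_lt _ x (by omega : i < j + 2), State.delete_of_lt _ x (by omega : i + 1 < j + 2),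
    State.delete_of_le _ x h, State.delete_of_le _ x (by omega : i ≤ j + 1), add_right_comm j 1 2]
  ring

theorem capOp_cupOp_far {i j : ℕ} (h : i ≤ j) : capOp (j + 2) * cupOp i = cupOp i * capOp j := by
  ext f x
  simp only [Module.End.mul_apply, capOp_apply, cupOp_apply, State.delete_insert_far _ _ x h,
    State.insert_of_lt _ _ _ x (by omega : i < j + 2),
    State.insert_of_lt _ _ _ x (by omega : i + 1 < j + 2)]
  ring

theorem cupOp_capOp_far {i j : ℕ} (h : i ≤ j) : cupOp j * capOp i = capOp i * cupOp (j + 2) := by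
  ext f x
  simp only [Module.End.mul_apply, capOp_apply, cupOp_apply, State.delete_far_insert _ _ x h,
    State.insert_add_two _ _ _ x h, add_right_comm j 2 1,
    State.insert_add_two _ _ _ x (by omega : i ≤ j + 1)]
  ring

theorem capOp_capOp_far {i j : ℕ} (h : i ≤ j) : capOp j * capOp i = capOp i * capOp (j + 2) := by
  ext f x
  simp only [Module.End.mul_apply, capOp_apply, State.insert_insert_far _ _ _ _ x h]
  ring

/-- The coefficient of the vertical smoothing of a crossing. -/
def crossingWeight (b : Bool) : ℤ := if b then 16 else 1

/-- The action of an event. -/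
def Slice.op : Slice → Module.End ℤ (State → ℤ)
  | .cup i => cupOp i
  | .cap i => capOp i
  | .crossing b i => crossingWeight b • 1 + cupOp i * capOp i
  | .dot _ => 1

/-- The action of a tangle diagram. -/
def bracketOp : List Slice → Module.End ℤ (State → ℤ)
  | [] => 1
  | s :: w => bracketOp w * s.op

theorem bracketOp_append (u v : List Slice) :
    bracketOp (u ++ v) = bracketOp v * bracketOp u := by
  induction u with
  | nil => simp [bracketOp]
  | cons s u ih => rw [List.cons_append, bracketOp, bracketOp, ih, mul_assoc]

theorem Slice.op_far (s t : Slice) (h : s.pos ≤ t.pos) :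
    (t.shift s.outs).op * s.op = s.op * (t.shift s.ins).op := by
  have h1 (i j : ℕ) (h : i ≤ j) :
      cupOp (j + 2) * capOp (j + 2) * cupOp i = cupOp i * (cupOp j * capOp j) := by
    rw [mul_assoc, capOp_cupOp_far h, ← mul_assoc, cupOp_cupOp_far h, mul_assoc]
  have h2 (i j : ℕ) (h : i ≤ j) :
      cupOp j * capOp j * capOp i = capOp i * (cupOp (j + 2) * capOp (j + 2)) := by
    rw [mul_assoc, capOp_capOp_far h, ← mul_assoc, cupOp_capOp_far h, mul_assoc]
  have h3 (i j : ℕ) (h : i ≤ j) :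
      cupOp (j + 2) * (cupOp i * capOp i) = cupOp i * capOp i * cupOp (j + 2) := by
    rw [← mul_assoc, cupOp_cupOp_far h, mul_assoc, cupOp_capOp_far h, mul_assoc]
  have h4 (i j : ℕ) (h : i ≤ j) :
      capOp (j + 2) * (cupOp i * capOp i) = cupOp i * capOp i * capOp (j + 2) := by
    rw [← mul_assoc, capOp_cupOp_far h, mul_assoc, capOp_capOp_far h, mul_assoc]
  cases s <;> cases t <;> simp only [Slice.pos] at h <;>
    simp only [Slice.op, Slice.shift, Slice.outs, Slice.ins, mul_one, one_mul, add_zero]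
  · exact cupOp_cupOp_far h
  · exact capOp_cupOp_far h
  · simp only [add_mul, mul_add, smul_mul_assoc, mul_smul_comm, one_mul, mul_one, h1 _ _ h]
  · exact cupOp_capOp_far h
  · exact capOp_capOp_far h
  · simp only [add_mul, mul_add, smul_mul_assoc, mul_smul_comm, one_mul, mul_one, h2 _ _ h]
  · simp only [add_mul, mul_add, smul_mul_assoc, mul_smul_comm, one_mul, mul_one, h3 _ _ h]
  · simp only [add_mul, mul_add, smul_mul_assoc, mul_smul_comm, one_mul, mul_one, h4 _ _ h]
  · rename_i b i c j
    have h5 : cupOp (j + 2) * capOp (j + 2) * (cupOp i * capOp i) =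
        cupOp i * capOp i * (cupOp (j + 2) * capOp (j + 2)) := by
      rw [mul_assoc, h4 _ _ h, ← mul_assoc, h3 _ _ h, mul_assoc]
    simp only [add_mul, mul_add, smul_mul_assoc, mul_smul_comm, one_mul, mul_one, h5]
    module

/-- Two operators agree up to sign and powers of two. -/
def Similar (F G : Module.End ℤ (State → ℤ)) : Prop :=
  ∃ a b k : ℕ, (2 ^ a : ℤ) • F = ((-1) ^ k * 2 ^ b : ℤ) • G

theorem Similar.of_eq {F G : Module.End ℤ (State → ℤ)} (h : F = G) : Similar F G :=
  ⟨0, 0, 0, by simp [h]⟩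

/-- These are the usual Temperley–Lieb computations with `E = cupOp i * capOp i` and `E² = -17 E`.
The crossings are `16 + E` and `1 + E`, that is, 8 and 2 times the normalised ones. A curl
contributes `-1` or `-16`, so even the first Reidemeister move costs only a sign and a power of two.
-/
theorem similar_of_localMove {r r' : List Slice} (h : LocalMove r r') :
    Similar (bracketOp r) (bracketOp r') := by
  have e1 (i : ℕ) : cupOp i * capOp i * cupOp i = (-17 : ℤ) • cupOp i := by
    rw [mul_assoc, capOp_mul_cupOp, mul_smul_comm, mul_one]
  have e2 (i : ℕ) : capOp i * (cupOp i * capOp i) = (-17 : ℤ) • capOp i := by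
    rw [← mul_assoc, capOp_mul_cupOp, smul_mul_assoc, one_mul]
  have e3 (i : ℕ) : cupOp i * capOp i * (cupOp i * capOp i) = (-17 : ℤ) • (cupOp i * capOp i) := by
    rw [← mul_assoc, e1, smul_mul_assoc]
  have e4 (i : ℕ) : cupOp (i + 1) * capOp (i + 1) * cupOp i = (4 : ℤ) • cupOp (i + 1) := by
    rw [mul_assoc, capOp_succ_mul_cupOp, mul_smul_comm, mul_one]
  have e5 (i : ℕ) : cupOp i * capOp i * cupOp (i + 1) = (4 : ℤ) • cupOp i := by
    rw [mul_assoc, capOp_mul_cupOp_succ, mul_smul_comm, mul_one]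
  have e6 (i : ℕ) : capOp i * (cupOp (i + 1) * capOp (i + 1)) = (4 : ℤ) • capOp (i + 1) := by
    rw [← mul_assoc, capOp_mul_cupOp_succ, smul_mul_assoc, one_mul]
  have e7 (i : ℕ) : capOp (i + 1) * (cupOp i * capOp i) = (4 : ℤ) • capOp i := by
    rw [← mul_assoc, capOp_succ_mul_cupOp, smul_mul_assoc, one_mul]
  cases h with
  | far s t h => exact .of_eq (by simpa [bracketOp] using Slice.op_far s t h)
  | zigzag_left i =>
    exact ⟨0, 2, 0, by simp [bracketOp, Slice.op, capOp_succ_mul_cupOp]⟩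
  | zigzag_right i =>
    exact ⟨0, 2, 0, by simp [bracketOp, Slice.op, capOp_mul_cupOp_succ]⟩
  | turn_cup b i =>
    cases b
    · refine ⟨2, 0, 0, ?_⟩
      simp only [bracketOp, Slice.op, crossingWeight, add_mul, one_mul, e4, e5, smul_mul_assoc,
        Bool.not_false, Bool.false_eq_true, if_true, if_false]
      module
    · refine ⟨0, 2, 0, ?_⟩
      simp only [bracketOp, Slice.op, crossingWeight, add_mul, one_mul, e4, e5, smul_mul_assoc,
        Bool.not_true, Bool.false_eq_true, if_true, if_false]
      module
  | turn_cap b i =>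
    cases b
    · refine ⟨2, 0, 0, ?_⟩
      simp only [bracketOp, Slice.op, crossingWeight, mul_add, mul_one, one_mul, e6, e7,
        mul_smul_comm, Bool.not_false, Bool.false_eq_true, if_true, if_false]
      module
    · refine ⟨0, 2, 0, ?_⟩
      simp only [bracketOp, Slice.op, crossingWeight, mul_add, mul_one, one_mul, e6, e7,
        mul_smul_comm, Bool.not_true, Bool.false_eq_true, if_true, if_false]
      module
  | reidemeister_one_cup b i =>
    cases b
    · refine ⟨0, 4, 1, ?_⟩
      simp only [bracketOp, Slice.op, crossingWeight, add_mul, one_mul, e1, smul_mul_assoc,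
        Bool.false_eq_true, if_false]
      module
    · refine ⟨0, 0, 1, ?_⟩
      simp only [bracketOp, Slice.op, crossingWeight, add_mul, one_mul, e1, smul_mul_assoc, if_true]
      module
  | reidemeister_one_cap b i =>
    cases b
    · refine ⟨0, 4, 1, ?_⟩
      simp only [bracketOp, Slice.op, crossingWeight, mul_add, mul_one, one_mul, e2, mul_smul_comm,
        Bool.false_eq_true, if_false]
      module
    · refine ⟨0, 0, 1, ?_⟩
      simp only [bracketOp, Slice.op, crossingWeight, mul_add, mul_one, one_mul, e2, mul_smul_comm,
        if_true]
      module
  | reidemeister_two b i =>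
    refine ⟨0, 4, 0, ?_⟩
    cases b <;>
    · simp only [bracketOp, Slice.op, crossingWeight, mul_add, add_mul, mul_one, one_mul, e3,
        mul_smul_comm, smul_mul_assoc, Bool.not_true, Bool.not_false, Bool.false_eq_true, if_true,
        if_false]
      module
  | reidemeister_three b i =>
    refine .of_eq ?_
    have e8 : cupOp i * capOp i * (cupOp (i + 1) * capOp (i + 1)) * (cupOp i * capOp i) =
        (16 : ℤ) • (cupOp i * capOp i) := by
      rw [← mul_assoc _ (cupOp (i + 1)), e5, smul_mul_assoc, smul_mul_assoc, mul_assoc, e7,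
        mul_smul_comm, smul_smul]
      norm_num
    have e9 : cupOp (i + 1) * capOp (i + 1) * (cupOp i * capOp i) *
        (cupOp (i + 1) * capOp (i + 1)) = (16 : ℤ) • (cupOp (i + 1) * capOp (i + 1)) := by
      rw [← mul_assoc _ (cupOp i), e4, smul_mul_assoc, smul_mul_assoc, mul_assoc, e6,
        mul_smul_comm, smul_smul]
      norm_num
    -- The two sides differ by `(c² - 17c + 16)(E - F)`, and the weights 16 and 1 are the roots of
    -- this polynomial.
    have key (c : ℤ) (hc : c * c - 17 * c + 16 = 0) (E F : Module.End ℤ (State → ℤ))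
        (hE : E * E = (-17 : ℤ) • E) (hF : F * F = (-17 : ℤ) • F)
        (hEF : E * F * E = (16 : ℤ) • E) (hFE : F * E * F = (16 : ℤ) • F) :
        (c • 1 + E) * (c • 1 + F) * (c • 1 + E) = (c • 1 + F) * (c • 1 + E) * (c • 1 + F) := by
      have h0 := congrArg (fun z : ℤ => z • (E - F)) hc
      simp only [zero_smul] at h0
      simp only [mul_add, add_mul, mul_one, one_mul, mul_smul_comm, smul_mul_assoc, hE, hF, hEF,
        hFE]
      rw [← sub_eq_zero, ← h0]
      module
    simp only [bracketOp, Slice.op, one_mul]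
    refine key _ ?_ _ _ (e3 i) (e3 (i + 1)) e8 e9
    cases b <;> rfl
  | dot_dot i => exact .of_eq rfl
  | dot_cup i => exact .of_eq rfl
  | dot_cap i => exact .of_eq rfl
  | dot_crossing_left b i => exact .of_eq rfl
  | dot_crossing_right b i => exact .of_eq rfl

/-- The value of the bracket on a diagram without loose ends. -/
def bracket (w : List Slice) : ℤ := bracketOp w (fun _ => 1) fun _ => false

/-- The bracket of a diagram, up to sign and powers of two. -/
def Link.oddBracket : Link → ℕ :=
  Quot.lift (fun D => ordCompl[2] (bracket D.1.word).natAbs) (by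
    rintro ⟨⟨_, h⟩, hD⟩ ⟨⟨_, h'⟩, hD'⟩ ⟨u, v, r, r', hr, rfl, rfl⟩
    obtain ⟨a, b, k, hk⟩ := similar_of_localMove hr
    have hz : (2 ^ a : ℤ) * bracket (u ++ r ++ v) = (-1) ^ k * 2 ^ b * bracket (u ++ r' ++ v) := by
      have hF : (2 ^ a : ℤ) • bracketOp (u ++ r ++ v) =
          ((-1) ^ k * 2 ^ b : ℤ) • bracketOp (u ++ r' ++ v) := by
        rw [bracketOp_append, bracketOp_append, bracketOp_append, bracketOp_append,
          ← mul_smul_comm, ← smul_mul_assoc, hk, smul_mul_assoc, mul_smul_comm]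
      exact congrFun (LinearMap.congr_fun hF fun _ => 1) fun _ => false
    -- Absolute value and odd part are multiplicative and remove the sign and the powers of two.
    have hn := congrArg (fun z : ℤ => ordCompl[2] z.natAbs) hz
    have h2 (n : ℕ) : ordCompl[2] (2 ^ n) = 1 := by
      rw [Nat.Prime.factorization_pow Nat.prime_two]; simp
    simpa only [Int.natAbs_mul, Int.natAbs_pow, Nat.ordCompl_mul, Int.natAbs_neg, Int.natAbs_one,
      one_pow, one_mul, show Int.natAbs 2 = 2 from rfl, h2] using hn)

/-! ### Evaluation of the bracket -/

/-- A colouring encoded by the binary digits of a number. -/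
def State.ofNat (m : ℕ) : State := m.testBit

/-- Deletion of two adjacent binary digits. -/
def deleteBits (i m : ℕ) : ℕ := m % 2 ^ i ||| (m >>> (i + 2)) <<< i

/-- Insertion of two adjacent binary digits. -/
def insertBits (i : ℕ) (a b : Bool) (m : ℕ) : ℕ :=
  m % 2 ^ i ||| (a.toNat ||| b.toNat <<< 1 ||| (m >>> i) <<< 2) <<< i

theorem State.delete_ofNat (i m : ℕ) : (ofNat m).delete i = ofNat (deleteBits i m) := by
  funext k
  simp only [delete, ofNat, deleteBits, Nat.testBit_or, Nat.testBit_mod_two_pow,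
    Nat.testBit_shiftLeft, Nat.testBit_shiftRight]
  split_ifs with h
  · simp [h]
  · simp [h, show i ≤ k by omega, show i + 2 + (k - i) = k + 2 by omega]

theorem State.insert_ofNat (i m : ℕ) (a b : Bool) :
    (ofNat m).insert i a b = ofNat (insertBits i a b m) := by
  funext k
  simp only [insert, ofNat, insertBits, Nat.testBit_or, Nat.testBit_mod_two_pow,
    Nat.testBit_shiftLeft, Nat.testBit_shiftRight]
  split_ifs with h h' h'
  · simp [h]
  · subst h'
    cases a <;> simp
  · subst h'
    cases a <;> cases b <;> simp <;> rfl
  · obtain ⟨l, rfl⟩ : ∃ l, k = i + (l + 2) := ⟨k - i - 2, by omega⟩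
    simp only [show i + (l + 2) - 2 = i + l by omega, Nat.add_sub_cancel_left]
    cases a <;> cases b <;> simp [Nat.testBit_succ]

/-- The value of the bracket of a diagram, read from top to bottom, on an encoded colouring. -/
def evalBracket : List Slice → ℕ → ℤ
  | [], _ => 1
  | .cup i :: w, m =>
    if m.testBit i = m.testBit (i + 1) then 0 else
      cupWeight (m.testBit i) (m.testBit (i + 1)) * evalBracket w (deleteBits i m)
  | .cap i :: w, m =>
    4 * evalBracket w (insertBits i true false m) - evalBracket w (insertBits i false true m)
  | .crossing b i :: w, m => crossingWeight b * evalBracket w m +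
    if m.testBit i = m.testBit (i + 1) then 0 else
      cupWeight (m.testBit i) (m.testBit (i + 1)) *
        (4 * evalBracket w (insertBits i true false (deleteBits i m)) -
          evalBracket w (insertBits i false true (deleteBits i m)))
  | .dot _ :: w, m => evalBracket w m

/-- Reading from the top evaluates the bracket at one colouring by a plain recursion on numbers.
Minima between equal colours cut branches off early, which keeps kernel evaluation feasible. -/
theorem bracketOp_reverse (w : List Slice) (m : ℕ) :
    bracketOp w.reverse (fun _ => 1) (State.ofNat m) = evalBracket w m := by
  have hw (a b : Bool) (z : ℤ) : cupWeight a b * z = if a = b then 0 else cupWeight a b * z := by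
    cases a <;> cases b <;> simp [cupWeight]
  have hb (k l : ℕ) : State.ofNat l k = l.testBit k := rfl
  induction w generalizing m with
  | nil => rfl
  | cons s w ih =>
    rw [List.reverse_cons, bracketOp_append]
    cases s with
    | cup i =>
      simp only [bracketOp, one_mul, Module.End.mul_apply, Slice.op, cupOp_apply, evalBracket,
        State.delete_ofNat, ih]
      exact hw _ _ _
    | cap i =>
      simp only [bracketOp, one_mul, Module.End.mul_apply, Slice.op, capOp_apply, evalBracket,
        State.insert_ofNat, ih]
    | crossing b i =>
      simp only [bracketOp, one_mul, Module.End.mul_apply, Slice.op, capOp_apply, cupOp_apply,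
        evalBracket, State.insert_ofNat, State.delete_ofNat, ih, LinearMap.add_apply,
        LinearMap.smul_apply, Module.End.one_apply, Pi.add_apply, Pi.smul_apply, smul_eq_mul]
      rw [hw]
      rfl
    | dot i => exact ih m

theorem bracket_eq_evalBracket (w : List Slice) : bracket w = evalBracket w.reverse 0 := by
  have h := bracketOp_reverse w.reverse 0
  rw [List.reverse_reverse] at h
  rw [← h, bracket, show State.ofNat 0 = fun _ => false from funext Nat.zero_testBit]

/-! ### The brackets of the Kanenobu knots -/

/-- The crossing `16 + E` has eigenvalues 16 and, where `E = -17`, `-1`. The factor 17 clears the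
denominator in its `m`-th power. -/
theorem bracketOp_replicate (m i : ℕ) :
    (17 : ℤ) • bracketOp (List.replicate m (.crossing true i)) =
      (17 * 16 ^ m : ℤ) • 1 + (16 ^ m - (-1) ^ m : ℤ) • (cupOp i * capOp i) := by
  have h : cupOp i * capOp i * (cupOp i * capOp i) = (-17 : ℤ) • (cupOp i * capOp i) := by
    rw [mul_assoc, ← mul_assoc (capOp i), capOp_mul_cupOp, smul_mul_assoc, one_mul, mul_smul_comm]
  induction m with
  | zero => simp [bracketOp]
  | succ m ih =>
    rw [List.replicate_succ, bracketOp, ← smul_mul_assoc, ih]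
    simp only [Slice.op, crossingWeight, if_true, add_mul, mul_add, smul_mul_assoc, mul_smul_comm,
      one_mul, mul_one, h, pow_succ]
    module

/-- The two constants are the brackets of `K_{0,0}` and of the diagram with the first twist region
smoothed horizontally; linearity in the twist region does the rest. -/
theorem bracket_kanenobuWord (m : ℕ) : 17 * bracket (kanenobuWord m 0) =
    16 ^ m * (17 * -16557383151872 + 4848615424) - (-1) ^ m * 4848615424 := by
  have h0 : bracket (kanenobuBase ++ (kanenobuMid ++ kanenobuTop)) = -16557383151872 := by
    rw [bracket_eq_evalBracket]
    decide +kernel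
  have h1 : bracket (kanenobuBase ++ [.cap 3, .cup 3] ++ (kanenobuMid ++ kanenobuTop)) =
      4848615424 := by
    rw [bracket_eq_evalBracket]
    decide +kernel
  have hw : kanenobuWord m 0 = kanenobuBase ++ List.replicate m (.crossing true 3) ++
      (kanenobuMid ++ kanenobuTop) := by
    rw [kanenobuWord_eq, replicate_eq_halfTwists]
    simp [halfTwists]
  have h := congrArg (fun F => bracketOp (kanenobuMid ++ kanenobuTop) * (F * bracketOp kanenobuBase))
    (bracketOp_replicate m 3)
  have h := congrFun (LinearMap.congr_fun h fun _ => 1) fun _ => false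
  simp only [add_mul, mul_add, smul_mul_assoc, mul_smul_comm, one_mul, LinearMap.add_apply,
    LinearMap.smul_apply, Pi.add_apply, Pi.smul_apply, smul_eq_mul, bracketOp_append] at h
  simp only [bracket, bracketOp_append, bracketOp, Slice.op, one_mul] at h0 h1
  rw [hw]
  simp only [bracket, bracketOp_append]
  rw [h, h0, h1]
  ring

/-- A small integer that differs from `z` by a multiple of a large power of two bounds the even part
of `z`. -/
theorem pow_le_mul_ordCompl {m : ℕ} {z n c : ℤ} (h : z = 16 ^ m * n - (-1) ^ m * c) (hn : n ≠ 0)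
    (hc : c ≠ 0) (hm : c.natAbs < 16 ^ m) :
    16 ^ m ≤ c.natAbs * (ordCompl[2] z.natAbs + 1) := by
  set v := z.natAbs.factorization 2
  have hu : IsUnit ((-1 : ℤ) ^ m) := (isUnit_one.neg).pow m
  have h16 : (16 : ℤ) ^ m = 2 ^ (4 * m) := by rw [pow_mul]; norm_num
  -- A power of two that divides both `z` and `16 ^ m` divides `c`.
  have hd : (2 : ℤ) ^ min v (4 * m) ∣ c := by
    have h1 : (2 : ℤ) ^ min v (4 * m) ∣ z :=
      (pow_dvd_pow 2 (min_le_left _ _)).trans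
        (Int.natCast_dvd.2 (by simpa using Nat.ordProj_dvd z.natAbs 2))
    have h2 : (2 : ℤ) ^ min v (4 * m) ∣ 16 ^ m * n :=
      Dvd.dvd.mul_right (h16 ▸ pow_dvd_pow 2 (min_le_right _ _)) _
    have h3 := dvd_sub h2 h1
    rw [h, sub_sub_cancel] at h3
    exact (hu.dvd_mul_left).1 h3
  have hle : 2 ^ min v (4 * m) ≤ c.natAbs :=
    Nat.le_of_dvd (Int.natAbs_pos.2 hc) (by simpa using Int.natAbs_dvd_natAbs.2 hd)
  have hv : min v (4 * m) = v := by
    refine min_eq_left (le_of_not_ge fun hge => ?_)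
    rw [min_eq_right hge, pow_mul] at hle
    exact absurd hm (not_lt.2 hle)
  rw [hv] at hle
  have h1 : z.natAbs ≤ c.natAbs * ordCompl[2] z.natAbs := by
    conv_lhs => rw [← Nat.ordProj_mul_ordCompl_eq_self z.natAbs 2]
    exact Nat.mul_le_mul_right _ hle
  have h2 : 16 ^ m ≤ z.natAbs + c.natAbs := by
    have h3 : 16 ^ m * n = z + (-1) ^ m * c := by rw [h]; ring
    calc 16 ^ m ≤ 16 ^ m * n.natAbs := Nat.le_mul_of_pos_right _ (Int.natAbs_pos.2 hn)
      _ = (16 ^ m * n).natAbs := by simp [Int.natAbs_mul, Int.natAbs_pow]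
      _ ≤ z.natAbs + ((-1) ^ m * c).natAbs := by rw [h3]; exact Int.natAbs_add_le _ _
      _ = z.natAbs + c.natAbs := by simp [Int.natAbs_mul, Int.natAbs_pow]
  linarith

theorem exists_lt_oddBracket (B : ℕ) : ∃ m : ℕ, B < (kanenobu m 0).link.oddBracket := by
  let c : ℕ := 4848615424
  -- The factor 17 is there because the formula concerns 17 times the bracket; an odd part at most
  -- `B` would give an odd part at most `17 * B`.
  obtain ⟨m, hm⟩ : ∃ m : ℕ, c * (17 * B + 1) < 16 ^ m := pow_unbounded_of_one_lt _ (by norm_num)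
  refine ⟨m, lt_of_not_ge fun hB => absurd hm (not_lt.2 ?_)⟩
  have h := pow_le_mul_ordCompl (bracket_kanenobuWord m) (by norm_num) (by norm_num)
    ((Nat.le_mul_of_pos_right c (Nat.succ_pos (17 * B))).trans_lt hm)
  refine h.trans (Nat.mul_le_mul_left c (Nat.add_le_add_right ?_ 1))
  rw [Int.natAbs_mul, Nat.ordCompl_mul]
  exact Nat.mul_le_mul (Nat.div_le_self _ _) hB

/-! ### Assembly -/

theorem isKnot_kanenobu (p q : ℤ) : (kanenobu p q).IsKnot :=
  DottedDiagram.numComponents_of_connected (connected_kanenobuWord p q) (by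
    simp [kanenobu, kanenobuWord])

theorem det_kanenobu (p q : ℤ) : (kanenobu p q).det = 25 :=
  (hasDet_kanenobuWord p q).2

theorem isTQA_kanenobu (p q : ℤ) : (kanenobu p q).link.IsTQA :=
  (q2_kanenobuWord p q).2

end TwoFold

theorem mainTheorem10 :
    (∀ p q : ℤ,
      (TwoFold.kanenobu p q).IsKnot ∧
      (TwoFold.kanenobu p q).det = 25 ∧
      (TwoFold.kanenobu p q).link.IsTQA) ∧
    {L : TwoFold.Link | L.IsTQA ∧
      ∃ D : TwoFold.LinkDiagram, D.link = L ∧ D.IsKnot ∧ D.det = 25}.Infinite := by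
  refine ⟨fun p q => ⟨TwoFold.isKnot_kanenobu p q, TwoFold.det_kanenobu p q,
    TwoFold.isTQA_kanenobu p q⟩, .of_image TwoFold.Link.oddBracket ?_⟩
  -- The invariant is unbounded already on the knots `K_{m,0}` with `m : ℕ`, so its image of the set
  -- is infinite.
  refine Set.infinite_of_forall_exists_gt fun B => ?_
  obtain ⟨m, hm⟩ := TwoFold.exists_lt_oddBracket B
  exact ⟨_, ⟨_, ⟨TwoFold.isTQA_kanenobu m 0, TwoFold.kanenobu m 0, rfl,
    TwoFold.isKnot_kanenobu m 0, TwoFold.det_kanenobu m 0⟩, rfl⟩, hm⟩
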